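/- Setting. Let $\lambda^F\ge 2$, $k^F\ge 1$, $r^I\ge 0$, $r^F\ge 1$ be integers and put $k^I=\lambda^F k^F$, $n^I=k^I+r^I$, $n^F=k^F+r^F$. Let $\mathbb F_q$ be a finite field and $\alpha\ge 1$. An $[n,k,\alpha]_q$ vector code is an injective (not necessarily linear) map $\mathcal C:(\mathbb F_q^{\alpha})^k\to(\mathbb F_q^{\alpha})^n$, whose $n$ output blocks are stored on $n$ nodes. It is MDS if the contents of any $k$ nodes determine the message, and systematic if there are $k$ distinct nodes (information nodes) that store the $k$ message blocks. An $(n^I,k^I=\lambda^Fk^F;n^F,k^F)$ convertible code (split regime) consists of an $[n^I,k^I,\alpha]_q$ initial code $\mathcal C^I$, an $[n^F,k^F,\alpha]_q$ final code $\mathcal C^F$, a partition $\mathcal P$ of $\{1,\dots,k^I\}$ into $\lambda^F$ blocks of size $k^F$, and a conversion procedure that turns $\mathcal C^I(m)$ into the codewords $\mathcal C^F(m_P)$, $P\in\mathcal P$, for every message $m$: each final node is either an unchanged initial node (each initial node serving as at most one final node) or a new node; the coordinator downloads from each initial node $i$ a deterministic function $D_i$ of its contents, and the contents of all new nodes are a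 function of $(D_1,\dots,D_{n^I})$. The convertible code is MDS (systematic) if both $\mathcal C^I$ and $\mathcal C^F$ are. Its read bandwidth cost is $\gamma_R=\sum_{i=1}^{n^I}H(D_i)$, where $H$ is the Shannon entropy to base $q$ and the message $m$ is uniformly distributed. Theorem. Every systematic MDS $(n^I,k^I=\lambda^Fk^F;n^F,k^F)$ convertible code satisfies $\gamma_R\ge B(\alpha)$, where $$ B(\alpha)=\begin{cases} \lambda^F r^F\alpha\,\dfrac{\left(\lambda^F-\lceil r^I/k^F\rceil\right)k^F+r^I}{\left(\lambda^F-\lceil r^I/k^F\rceil\right)r^F+r^I} & \text{if } (r^I\bmod k^F)\ge r^F,\ r^F<r^I\le k^I,\ r^F<k^F,\\[2ex] \lambda^F k^F\alpha-\lambda^F r^I\alpha\,\dfrac{k^F-r^F}{\left(\lambda^F-\lfloor r^I/k^F\rfloor\right)r^F+\lfloor r^I/k^F\rfloor k^F} & \text{if } (r^I\bmod k^F)<r^F,\ r^F<r^I\le k^I,\ r^F<k^F,\\[2ex] \lambda^F k^F\alpha-r^I\alpha\left(\dfrac{k^F}{r^F}-1\right) & \text{if } r^I\le r^F<k^F,\\[1ex]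 \lambda^F\min\{k^F,r^F\}\,\alpha & \text{otherwise.} \end{cases} $$ Moreover, the bound is tight when $r^F\ge k^F$ or $r^I\le k^F$: for all such parameters there exist a finite field $\mathbb F_q$, an $\alpha\ge1$ and a systematic MDS $(n^I,k^I=\lambda^Fk^F;n^F,k^F)$ convertible code with $\gamma_R=B(\alpha)$, in which moreover the initial information nodes remain unchanged and serve as the information nodes of the final codewords. -/

import Mathlib

namespace MDSConversion

/-- The contents of one storage node: `α` subsymbols over the alphabet `F`. -/
abbrev Block (F : Type*) (α : ℕ) : Type _ := Fin α → F

/-- A (possibly nonlinear) vector code with message length `k` and block length `n`: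
an injective map from `k` message symbols to `n` code symbols, each symbol being a block of
`α` subsymbols. -/
structure VectorCode (F : Type*) (α n k : ℕ) where
  enc : (Fin k → Block F α) → (Fin n → Block F α)
  injective : Function.Injective enc

namespace VectorCode

variable {F : Type*} {α n k : ℕ}

/-- MDS property: the message is determined by the contents of any `k` of the `n` nodes. -/
def IsMDS (C : VectorCode F α n k) : Prop :=
  ∀ S : Finset (Fin n), S.card = k →
    ∀ m m' : Fin k → Block F α, (∀ i ∈ S, C.enc m i = C.enc m' i) → m = m'

/-- `info` lists information nodes of `C`: the node `info j` stores the message symbol `j`. -/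
def IsSystematicAt (C : VectorCode F α n k) (info : Fin k ↪ Fin n) : Prop :=
  ∀ (m : Fin k → Block F α) (j : Fin k), C.enc m (info j) = m j

/-- `C` is systematic. -/
def IsSystematic (C : VectorCode F α n k) : Prop :=
  ∃ info : Fin k ↪ Fin n, C.IsSystematicAt info

end VectorCode

/-- A convertible code with a single initial codeword, i.e. with `kF ∣ kI`, so that the common
message index set is `Fin kI` and its initial partition has only one block.  It consists of an
initial code, a final code, a partition of the message index set into blocks of size `kF` (one
final codeword per block), and a conversion procedure.

In the conversion procedure a final node is either an unchanged initial node or a new node.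
The coordinator downloads from each initial node a deterministic function of its contents and
computes the contents of all new nodes from the downloaded data. -/
structure SplitConvertibleCode (F : Type*) (α nI kI nF kF : ℕ) where
  /-- the initial code -/
  initial : VectorCode F α nI kI
  /-- the final code, used for every block of the partition -/
  final : VectorCode F α nF kF
  /-- the partition of the message indices among the final codewords -/
  partition : Finpartition (Finset.univ : Finset (Fin kI))
  card_part : ∀ P ∈ partition.parts, P.card = kF
  /-- `source P l = some i` : node `l` of the final codeword of `P` is the unchanged initial
  node `i`;  `source P l = none` : it is a new node. -/
  source : partition.parts → Fin nF → Option (Fin nI)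
  /-- an initial node remains as at most one final node -/
  source_inj : ∀ (P P' : partition.parts) (l l' : Fin nF) (i : Fin nI),
    source P l = some i → source P' l' = some i → P = P' ∧ l = l'
  /-- the set of possible values of the data downloaded from each initial node -/
  Download : Fin nI → Type
  [fintypeDownload : ∀ i, Fintype (Download i)]
  /-- what is downloaded from an initial node, as a function of its contents -/
  read : (i : Fin nI) → Block F α → Download i
  /-- the contents of the new nodes, computed from the downloaded data -/
  write : ((i : Fin nI) → Download i) → partition.parts → Fin nF → Block F α
  /-- an unchanged node holds the right symbol of the final codeword -/
  unchanged_correct : ∀ (m : Fin kI → Block F α) (P : partition.parts) (l : Fin nF) (i : Fin nI),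
    source P l = some i →
      final.enc (fun j => m ((P : Finset (Fin kI)).orderEmbOfFin (card_part P P.2) j)) l
        = initial.enc m i
  /-- a new node receives the right symbol of the final codeword -/
  new_correct : ∀ (m : Fin kI → Block F α) (P : partition.parts) (l : Fin nF),
    source P l = none →
      final.enc (fun j => m ((P : Finset (Fin kI)).orderEmbOfFin (card_part P P.2) j)) l
        = write (fun i => read i (initial.enc m i)) P l

attribute [instance] SplitConvertibleCode.fintypeDownload

/-- Shannon entropy, in base `b`, of a probability distribution on a finite set. -/
noncomputable def entropy (b : ℕ) {S : Type*} [Fintype S] (p : PMF S) : ℝ :=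
  (∑ s, Real.negMulLog (p s).toReal) / Real.log b

namespace SplitConvertibleCode

variable {F : Type*} {α nI kI nF kF : ℕ}

/-- Both the initial and the final code are MDS. -/
def IsMDS (Z : SplitConvertibleCode F α nI kI nF kF) : Prop :=
  Z.initial.IsMDS ∧ Z.final.IsMDS

/-- Both the initial and the final code are systematic. -/
def IsSystematic (Z : SplitConvertibleCode F α nI kI nF kF) : Prop :=
  Z.initial.IsSystematic ∧ Z.final.IsSystematic

/-- The initial information nodes remain unchanged and serve as the information nodes of the
final codewords. -/
def KeepsInformationNodes (Z : SplitConvertibleCode F α nI kI nF kF) : Prop :=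
  ∃ (infoI : Fin kI ↪ Fin nI) (infoF : Fin kF ↪ Fin nF),
    Z.initial.IsSystematicAt infoI ∧ Z.final.IsSystematicAt infoF ∧
      ∀ (P : Z.partition.parts) (j : Fin kF),
        Z.source P (infoF j) =
          some (infoI ((P : Finset (Fin kI)).orderEmbOfFin (Z.card_part P P.2) j))

/-- The read bandwidth cost: the sum over all initial nodes of the entropy (in units of symbols
of `F`) of the data downloaded from the node, the message being uniformly distributed. -/
noncomputable def readBandwidthCost [Field F] [Fintype F]
    (Z : SplitConvertibleCode F α nI kI nF kF) : ℝ :=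
  ∑ i : Fin nI, entropy (Fintype.card F)
    ((PMF.uniformOfFintype (Fin kI → Block F α)).map fun m => Z.read i (Z.initial.enc m i))

end SplitConvertibleCode

/-- The four-case lower bound, for `kI = lam * kF`, `nI = kI + rI`, `nF = kF + rF`. -/
noncomputable def splitBound (lam kF rI rF α : ℕ) : ℝ :=
  if rF < rI ∧ rI ≤ lam * kF ∧ rF < kF ∧ rF ≤ rI % kF then
    (lam : ℝ) * rF * α *
      ((((lam : ℝ) - ⌈(rI : ℝ) / kF⌉) * kF + rI) / (((lam : ℝ) - ⌈(rI : ℝ) / kF⌉) * rF + rI))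
  else if rF < rI ∧ rI ≤ lam * kF ∧ rF < kF ∧ rI % kF < rF then
    (lam : ℝ) * kF * α - (lam : ℝ) * rI * α *
      (((kF : ℝ) - rF) /
        (((lam : ℝ) - ⌊(rI : ℝ) / kF⌋) * rF + (⌊(rI : ℝ) / kF⌋ : ℝ) * kF))
  else if rI ≤ rF ∧ rF < kF then
    (lam : ℝ) * kF * α - (rI : ℝ) * α * ((kF : ℝ) / rF - 1)
  else
    (lam : ℝ) * (min kF rF : ℕ) * α

end MDSConversion

/-!
**Lower bound.**  All random variables are functions of the uniformly distributed message, so joint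
entropies are entropies of infima in the lattice of partitions of the message space, and the only
fact about entropy that is needed is submodularity (`partitionEntropy_submodular`).  Write `k`, `r`
for `kF`, `rF`, let `s = rI`, and let `L` be the entropy of a block.  Since the initial code
is MDS and systematic, an unchanged node of a final codeword is one of the information
nodes of its stripe (`exists_info_of_source`).  For each stripe let `d` be the entropy read from its
information nodes and `U` the entropy that its new nodes add to these data.

* The new nodes and `k - min k r` of the information nodes determine the stripe; averaging over
  the choice of the information nodes gives `k * U ≥ min k r * (k * L - d)` (`newEntropy_ge`).
* The new nodes are computed from the data read, and the stripes are independent; so the sum of all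
  `U` is at most the entropy read from the parity nodes (`sum_newEntropy_le`).
* For a set `T` of `s` information nodes, the parity nodes and the information nodes outside `T`
  are independent.  The new nodes of a stripe depend on no other stripe, so the data read from the
  parity nodes are of use only after the interference of the blocks in `T` is cancelled by
  data read from `T` (`sum_entropy_known_add_le`).  Let `f = s / k` and `b = s % k`. Taking for `T`
  a union of `f` stripes and `b` further nodes, and averaging over the choices, bounds
  `θ * ∑ U` by `s / k * ∑ d` with `θ = lam - f - min 1 (b / r)`.

Eliminating `U` from these linear inequalities yields the four cases of the bound.

**Tightness.**  By the lower bound it suffices to exhibit codes for which the number of subsymbols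
read does not exceed the bound.  The codes are piggybacked: each parity node stores scalar parities
of every subsymbol, with some of them increased by parities of other subsymbols.  The scalar
parities come from a matrix of powers `x ^ i` with all minors nonzero, whose column blocks for
different stripes agree up to a scaling of the rows (`exists_superregular_blocks`); over the
integers the minors are nonzero by Descartes' rule of signs, hence also modulo a large prime.  For
`s ≤ r` the parity nodes carry as piggybacks those final parities of one stripe for which there are
no initial parity nodes (`exists_convertibleCode_of_few_parities`).  For `r < s ≤ k` each
stripe leaves unread `r` subsymbols of its own, at which all other stripes are read, and `s - r` subsymbols at which
no stripe is read.  The parity nodes provide `r * s` usable parities at the former, `r * r` of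
them for these subsymbols and `r * (s - r)` as piggybacks for the latter
(`exists_convertibleCode_of_many_parities`).  A piggyback cannot be separated from the scalar parity
that it is added to, so the final code stores their sum.
-/

namespace MDSConversion

/-! ### Entropy of partitions of a finite uniform probability space -/

section PartitionEntropy

variable {Ω : Type*} [Fintype Ω]

open Classical in
/-- The number of elements equivalent to `ω`. -/
noncomputable def classCard (a : Setoid Ω) (ω : Ω) : ℕ :=
  (Finset.univ.filter fun ω' => a ω ω').card

/-- The Shannon entropy, in nats, of the class of a uniformly distributed element of `Ω` in the
partition of `Ω` given by `a`.  The entropy of a random variable `f : Ω → S` is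
`partitionEntropy (Setoid.ker f)`; joint entropies are entropies of infima of setoids, and
`a ≤ b` says that the class of `a` determines the class of `b`. -/
noncomputable def partitionEntropy (a : Setoid Ω) : ℝ :=
  (∑ ω, (Real.log (Fintype.card Ω) - Real.log (classCard a ω))) / Fintype.card Ω

theorem classCard_pos (a : Setoid Ω) (ω : Ω) : 0 < classCard a ω := by
  classical
  exact Finset.card_pos.2 ⟨ω, by simp⟩

theorem classCard_eq_of_rel {a : Setoid Ω} {ω ω' : Ω} (h : a ω ω') :
    classCard a ω = classCard a ω' := by
  classical
  unfold classCard
  congr 1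
  ext x
  simp only [Finset.mem_filter, Finset.mem_univ, true_and]
  exact ⟨fun hx => a.trans (a.symm h) hx, fun hx => a.trans h hx⟩

open Classical in
theorem classCard_eq_sum (a : Setoid Ω) (ω : Ω) :
    (classCard a ω : ℝ) = ∑ ω', if a ω ω' then 1 else 0 := by
  simp [classCard]

theorem partitionEntropy_anti {a b : Setoid Ω} (h : a ≤ b) :
    partitionEntropy b ≤ partitionEntropy a := by
  classical
  unfold partitionEntropy
  gcongr with ω
  · exact_mod_cast classCard_pos a ω
  · unfold classCard
    gcongr with ω'
    exact fun hx => h hx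

theorem partitionEntropy_top : partitionEntropy (⊤ : Setoid Ω) = 0 := by
  classical
  have : ∀ ω : Ω, classCard (⊤ : Setoid Ω) ω = Fintype.card Ω := by
    intro ω
    unfold classCard
    rw [Finset.filter_true_of_mem (fun _ _ => by simp [Setoid.top_def])]
    rfl
  simp [partitionEntropy, this]

theorem partitionEntropy_bot [Nonempty Ω] :
    partitionEntropy (⊥ : Setoid Ω) = Real.log (Fintype.card Ω) := by
  classical
  have : ∀ ω : Ω, classCard (⊥ : Setoid Ω) ω = 1 := by
    intro ω
    unfold classCard
    rw [Finset.card_eq_one]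
    exact ⟨ω, by ext x; simp [eq_comm]⟩
  simp [partitionEntropy, this]

open Classical in
/-- The sum is over a class of `a ⊓ b` or empty. -/
theorem sum_rel_div_classCard_inf_le_one (a b : Setoid Ω) (ω₁ ω₂ : Ω) :
    ∑ ω, (if a ω ω₁ ∧ b ω ω₂ then (1 : ℝ) / classCard (a ⊓ b) ω else 0) ≤ 1 := by
  by_cases h : ∃ ω₀, a ω₀ ω₁ ∧ b ω₀ ω₂
  · obtain ⟨ω₀, h1, h2⟩ := h
    have key : ∀ ω, (if a ω ω₁ ∧ b ω ω₂ then (1 : ℝ) / classCard (a ⊓ b) ω else 0)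
        = (if (a ⊓ b) ω₀ ω then 1 else 0) / classCard (a ⊓ b) ω₀ := by
      intro ω
      have hiff : (a ω ω₁ ∧ b ω ω₂) ↔ (a ⊓ b) ω₀ ω := by
        constructor
        · rintro ⟨h3, h4⟩
          exact ⟨a.trans h1 (a.symm h3), b.trans h2 (b.symm h4)⟩
        · rintro ⟨h3, h4⟩
          exact ⟨a.trans (a.symm h3) h1, b.trans (b.symm h4) h2⟩
      by_cases hr : (a ⊓ b) ω₀ ω
      · rw [if_pos (hiff.2 hr), if_pos hr, classCard_eq_of_rel hr]
      · rw [if_neg (fun hx => hr (hiff.1 hx)), if_neg hr, zero_div]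
    rw [Finset.sum_congr rfl fun ω _ => key ω, ← Finset.sum_div, ← classCard_eq_sum]
    exact (div_self (by exact_mod_cast (classCard_pos _ _).ne')).le
  · rw [Finset.sum_eq_zero]
    · exact zero_le_one
    · intro ω _
      rw [if_neg (fun hx => h ⟨ω, hx⟩)]

theorem sum_classCard_ratio_le {a b c : Setoid Ω} (hac : a ≤ c) (hbc : b ≤ c) :
    ∑ ω, (classCard a ω * classCard b ω : ℝ) / (classCard c ω * classCard (a ⊓ b) ω)
      ≤ Fintype.card Ω := by
  classical
  calc ∑ ω, (classCard a ω * classCard b ω : ℝ) / (classCard c ω * classCard (a ⊓ b) ω)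
      = ∑ ω, ∑ ω₁, ∑ ω₂, (if a ω ω₁ ∧ b ω ω₂ then (1 : ℝ) / classCard (a ⊓ b) ω else 0)
          * ((if c ω₁ ω₂ then 1 else 0) / classCard c ω₁) := by
        refine Finset.sum_congr rfl fun ω _ => ?_
        rw [classCard_eq_sum a, classCard_eq_sum b, Finset.sum_mul_sum, Finset.sum_div]
        refine Finset.sum_congr rfl fun ω₁ _ => ?_
        rw [Finset.sum_div]
        refine Finset.sum_congr rfl fun ω₂ _ => ?_
        by_cases h1 : a ω ω₁
        · by_cases h2 : b ω ω₂
          · have hc : c ω₁ ω₂ := c.trans (c.symm (hac h1)) (hbc h2)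
            rw [if_pos h1, if_pos h2, if_pos ⟨h1, h2⟩, if_pos hc,
              classCard_eq_of_rel (hac h1)]
            have e1 : (classCard c ω₁ : ℝ) ≠ 0 := by exact_mod_cast (classCard_pos _ _).ne'
            have e2 : (classCard (a ⊓ b) ω : ℝ) ≠ 0 := by
              exact_mod_cast (classCard_pos _ _).ne'
            field_simp
          · simp [h2]
        · simp [h1]
    _ = ∑ ω₁, ∑ ω₂, (∑ ω, (if a ω ω₁ ∧ b ω ω₂ then (1 : ℝ) / classCard (a ⊓ b) ω else 0))
          * ((if c ω₁ ω₂ then 1 else 0) / classCard c ω₁) := by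
        rw [Finset.sum_comm]
        refine Finset.sum_congr rfl fun ω₁ _ => ?_
        rw [Finset.sum_comm]
        exact Finset.sum_congr rfl fun ω₂ _ => (Finset.sum_mul _ _ _).symm
    _ ≤ ∑ ω₁, ∑ ω₂, 1 * ((if c ω₁ ω₂ then 1 else 0) / (classCard c ω₁ : ℝ)) := by
        refine Finset.sum_le_sum fun ω₁ _ => Finset.sum_le_sum fun ω₂ _ => ?_
        refine mul_le_mul_of_nonneg_right (sum_rel_div_classCard_inf_le_one a b ω₁ ω₂) ?_
        split_ifs <;> positivity
    _ = ∑ ω₁ : Ω, (1 : ℝ) := by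
        refine Finset.sum_congr rfl fun ω₁ _ => ?_
        simp_rw [one_mul]
        rw [← Finset.sum_div, ← classCard_eq_sum]
        exact div_self (by exact_mod_cast (classCard_pos _ _).ne')
    _ = Fintype.card Ω := by simp

/-- Submodularity of entropy (nonnegativity of conditional mutual information). -/
theorem partitionEntropy_submodular {a b c : Setoid Ω} (hac : a ≤ c) (hbc : b ≤ c) :
    partitionEntropy (a ⊓ b) + partitionEntropy c ≤ partitionEntropy a + partitionEntropy b := by
  unfold partitionEntropy
  rw [← add_div, ← add_div]
  refine div_le_div_of_nonneg_right ?_ (Nat.cast_nonneg _)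
  rw [← Finset.sum_add_distrib, ← Finset.sum_add_distrib, ← sub_nonpos,
    ← Finset.sum_sub_distrib]
  have hterm : ∀ ω, (Real.log (Fintype.card Ω) - Real.log (classCard (a ⊓ b) ω) +
      (Real.log (Fintype.card Ω) - Real.log (classCard c ω)) -
      (Real.log (Fintype.card Ω) - Real.log (classCard a ω) +
      (Real.log (Fintype.card Ω) - Real.log (classCard b ω)))) ≤
      (classCard a ω * classCard b ω : ℝ) / (classCard c ω * classCard (a ⊓ b) ω) - 1 := by
    intro ω
    have ha : (0 : ℝ) < classCard a ω := by exact_mod_cast classCard_pos a ω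
    have hb : (0 : ℝ) < classCard b ω := by exact_mod_cast classCard_pos b ω
    have hc : (0 : ℝ) < classCard c ω := by exact_mod_cast classCard_pos c ω
    have hab : (0 : ℝ) < classCard (a ⊓ b) ω := by exact_mod_cast classCard_pos (a ⊓ b) ω
    have := Real.log_le_sub_one_of_pos (div_pos (mul_pos ha hb) (mul_pos hc hab))
    rw [Real.log_div (by positivity) (by positivity), Real.log_mul ha.ne' hb.ne',
      Real.log_mul hc.ne' hab.ne'] at this
    linarith
  refine (Finset.sum_le_sum fun ω _ => hterm ω).trans ?_
  rw [Finset.sum_sub_distrib, Finset.sum_const, Finset.card_univ, nsmul_eq_mul, mul_one]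
  linarith [sum_classCard_ratio_le hac hbc]

theorem partitionEntropy_inf_le (a b : Setoid Ω) :
    partitionEntropy (a ⊓ b) ≤ partitionEntropy a + partitionEntropy b := by
  have := partitionEntropy_submodular (le_top : a ≤ ⊤) (le_top : b ≤ ⊤)
  rwa [partitionEntropy_top, add_zero] at this

/-- Mutual information does not increase when both variables are coarsened. -/
theorem partitionEntropy_mutual_mono {X Y x y : Setoid Ω} (hX : X ≤ Y) (hx : x ≤ y) :
    partitionEntropy (X ⊓ x) + partitionEntropy Y + partitionEntropy y ≤
      partitionEntropy X + partitionEntropy x + partitionEntropy (Y ⊓ y) := by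
  have h1 := partitionEntropy_submodular (a := X) (b := Y ⊓ y) (c := Y) hX inf_le_left
  have h2 := partitionEntropy_submodular (a := X ⊓ y) (b := x) (c := y) inf_le_right hx
  rw [← inf_assoc, inf_eq_left.2 hX] at h1
  rw [inf_assoc, inf_eq_right.2 hx] at h2
  linarith

theorem partitionEntropy_finset_inf_le {ι : Type*} (A : Finset ι) (x : ι → Setoid Ω) :
    partitionEntropy (A.inf x) ≤ ∑ i ∈ A, partitionEntropy (x i) := by
  classical
  induction A using Finset.induction_on with
  | empty => simp [partitionEntropy_top]
  | insert i A hi ih =>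
    rw [Finset.inf_insert, Finset.sum_insert hi]
    linarith [partitionEntropy_inf_le (x i) (A.inf x)]

/-- Coarsenings of independent variables are independent: the right inequality for the finer
family `x` implies the same for the coarser family `y`. -/
theorem sum_partitionEntropy_le_of_le {ι : Type*} (A : Finset ι) {x y : ι → Setoid Ω}
    (hxy : ∀ i ∈ A, x i ≤ y i)
    (hx : ∑ i ∈ A, partitionEntropy (x i) ≤ partitionEntropy (A.inf x)) :
    ∑ i ∈ A, partitionEntropy (y i) ≤ partitionEntropy (A.inf y) := by
  classical
  suffices h : partitionEntropy (A.inf x) + ∑ i ∈ A, partitionEntropy (y i) ≤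
      partitionEntropy (A.inf y) + ∑ i ∈ A, partitionEntropy (x i) by linarith
  clear hx
  induction A using Finset.induction_on with
  | empty => simp
  | insert i A hi ih =>
    rw [Finset.inf_insert, Finset.sum_insert hi, Finset.inf_insert, Finset.sum_insert hi]
    have h1 := ih fun j hj => hxy j (Finset.mem_insert_of_mem hj)
    have h2 := partitionEntropy_mutual_mono (hxy i (Finset.mem_insert_self i A))
      (Finset.inf_mono_fun fun j hj => hxy j (Finset.mem_insert_of_mem hj) : A.inf x ≤ A.inf y)
    linarith

theorem classCard_ker_eq {S : Type*} [DecidableEq S] (f : Ω → S) {ω : Ω} {s : S} (h : f ω = s) :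
    classCard (Setoid.ker f) ω = (Finset.univ.filter fun ω' => f ω' = s).card := by
  classical
  refine congrArg Finset.card ?_
  ext ω'
  simp [Setoid.ker_def, h, eq_comm]

theorem sum_inv_classCard_ker_le {S : Type*} [Fintype S] (f : Ω → S) :
    ∑ ω, (1 : ℝ) / classCard (Setoid.ker f) ω ≤ Fintype.card S := by
  classical
  rw [← Finset.sum_fiberwise (s := Finset.univ) (g := f)]
  have : (Fintype.card S : ℝ) = ∑ _s : S, (1 : ℝ) := by simp
  rw [this]
  refine Finset.sum_le_sum fun s _ => ?_
  have hc : ∀ ω ∈ Finset.univ.filter (fun ω => f ω = s), (1 : ℝ) / classCard (Setoid.ker f) ω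
      = 1 / (Finset.univ.filter (fun ω => f ω = s)).card := by
    intro ω hω
    rw [Finset.mem_filter] at hω
    rw [classCard_ker_eq f hω.2]
  rw [Finset.sum_congr rfl hc, Finset.sum_const, nsmul_eq_mul]
  rw [mul_one_div]
  exact div_self_le_one _

theorem partitionEntropy_ker_le_log_card [Nonempty Ω] {S : Type*} [Fintype S] (f : Ω → S) :
    partitionEntropy (Setoid.ker f) ≤ Real.log (Fintype.card S) := by
  have hΩ : (0 : ℝ) < Fintype.card Ω := by exact_mod_cast Fintype.card_pos
  have hS : (0 : ℝ) < Fintype.card S := by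
    have : Nonempty S := ⟨f (Classical.arbitrary Ω)⟩
    exact_mod_cast Fintype.card_pos
  unfold partitionEntropy
  rw [div_le_iff₀ hΩ]
  have hterm : ∀ ω, Real.log (Fintype.card Ω) - Real.log (classCard (Setoid.ker f) ω) ≤
      Real.log (Fintype.card S) +
        ((Fintype.card Ω / Fintype.card S : ℝ) * (1 / classCard (Setoid.ker f) ω) - 1) := by
    intro ω
    have hc : (0 : ℝ) < classCard (Setoid.ker f) ω := by exact_mod_cast classCard_pos _ ω
    have := Real.log_le_sub_one_of_pos (mul_pos (div_pos hΩ hS) (one_div_pos.2 hc))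
    rw [Real.log_mul (by positivity) (by positivity), Real.log_div hΩ.ne' hS.ne',
      Real.log_div one_ne_zero hc.ne', Real.log_one] at this
    linarith
  refine (Finset.sum_le_sum fun ω _ => hterm ω).trans ?_
  rw [Finset.sum_add_distrib, Finset.sum_sub_distrib, ← Finset.mul_sum]
  simp only [Finset.sum_const, Finset.card_univ, nsmul_eq_mul, mul_one]
  have h1 := mul_le_mul_of_nonneg_left (sum_inv_classCard_ker_le f) (div_pos hΩ hS).le
  rw [div_mul_cancel₀ _ hS.ne'] at h1
  linarith

theorem entropy_map_uniform [Nonempty Ω] {S : Type*} [Fintype S] (b : ℕ) (f : Ω → S) :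
    entropy b ((PMF.uniformOfFintype Ω).map f) =
      partitionEntropy (Setoid.ker f) / Real.log b := by
  classical
  have hΩ : (0 : ℝ) < Fintype.card Ω := by exact_mod_cast Fintype.card_pos
  unfold entropy partitionEntropy
  congr 1
  rw [← Finset.sum_fiberwise (s := Finset.univ) (g := f), Finset.sum_div]
  refine Finset.sum_congr rfl fun s _ => ?_
  have hp : (((PMF.uniformOfFintype Ω).map f) s).toReal =
      (Finset.univ.filter (fun ω => f ω = s)).card / Fintype.card Ω := by
    rw [PMF.map_apply, tsum_fintype, ← Finset.sum_filter]
    simp only [PMF.uniformOfFintype_apply, Finset.sum_const, nsmul_eq_mul, ENNReal.toReal_mul,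
      ENNReal.toReal_natCast, ENNReal.toReal_inv, div_eq_mul_inv]
    congr 4
    ext ω
    simp [eq_comm]
  have hc : ∀ ω ∈ Finset.univ.filter (fun ω => f ω = s),
      Real.log (Fintype.card Ω) - Real.log (classCard (Setoid.ker f) ω)
      = Real.log (Fintype.card Ω) -
        Real.log ((Finset.univ.filter (fun ω => f ω = s)).card) := by
    intro ω hω
    rw [Finset.mem_filter] at hω
    rw [classCard_ker_eq f hω.2]
  rw [hp, Finset.sum_congr rfl hc, Finset.sum_const, nsmul_eq_mul, Real.negMulLog]
  rcases Nat.eq_zero_or_pos (Finset.univ.filter (fun ω => f ω = s)).card with h0 | h0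
  · simp [h0]
  · have h0' : (0 : ℝ) < (Finset.univ.filter (fun ω => f ω = s)).card := by exact_mod_cast h0
    rw [Real.log_div h0'.ne' hΩ.ne']
    ring

end PartitionEntropy

/-! ### Averaging lemmas -/

/-- Some `n`-element subset of `s` carries at least the average share `n / |s|` of the sum. -/
theorem exists_subset_card_mul_sum_le {ι : Type*} [DecidableEq ι] (f : ι → ℝ) (s : Finset ι)
    (n : ℕ) (hn : n ≤ s.card) :
    ∃ V ⊆ s, V.card = n ∧ (n : ℝ) * ∑ i ∈ s, f i ≤ s.card * ∑ i ∈ V, f i := by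
  induction s using Finset.strongInduction with
  | H s ih =>
    rcases hn.eq_or_lt with h | h
    · exact ⟨s, Finset.Subset.refl _, h.symm, by rw [h]⟩
    · rcases Nat.eq_zero_or_pos n with rfl | hn0
      · exact ⟨∅, by simp, by simp, by simp⟩
      obtain ⟨a, ha, hmin⟩ := s.exists_min_image f (Finset.card_pos.1 (by omega))
      have hc := Finset.card_erase_of_mem ha
      obtain ⟨V, hV, hVn, hle⟩ := ih (s.erase a) (Finset.erase_ssubset ha) (by omega)
      refine ⟨V, hV.trans (Finset.erase_subset _ _), hVn, ?_⟩
      have hsum := Finset.add_sum_erase s f ha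
      have hmin' : (s.card : ℝ) * f a ≤ ∑ i ∈ s, f i := by
        rw [← nsmul_eq_mul]
        exact Finset.card_nsmul_le_sum s f _ hmin
      have hcr : ((s.erase a).card : ℝ) = s.card - 1 := by
        rw [hc, Nat.cast_sub (by omega), Nat.cast_one]
      have hpos : (0 : ℝ) < (s.erase a).card := by
        rw [hc]
        exact_mod_cast (by omega : 0 < s.card - 1)
      rw [hcr] at hle hpos
      have hn0' : (0 : ℝ) ≤ n := Nat.cast_nonneg n
      have h2 := mul_le_mul_of_nonneg_left hmin' hn0'
      have h3 := mul_le_mul_of_nonneg_left hle (by linarith : (0 : ℝ) ≤ s.card)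
      refine le_of_mul_le_mul_left ?_ hpos
      rw [← hsum] at h2 ⊢
      nlinarith

/-- A weighted inequality that holds for all orderings of a finite type holds on average. -/
theorem sum_mul_sum_le_of_forall_equiv {π : Type*} [Fintype π] {n : ℕ} (hn : 0 < n)
    (e : Fin n ≃ π) (p q : Fin n → ℝ) (U d : π → ℝ) (c : ℝ)
    (h : ∀ σ : Fin n ≃ π, ∑ i, p i * U (σ i) ≤ ∑ i, q i * d (σ i) + c) :
    (∑ i, p i) * ∑ x, U x ≤ (∑ i, q i) * ∑ x, d x + n * c := by
  have : NeZero n := ⟨hn.ne'⟩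
  have rot : ∀ (w : Fin n → ℝ) (v : π → ℝ),
      ∑ t : Fin n, ∑ i, w i * v (((Equiv.addRight t).trans e) i) = (∑ i, w i) * ∑ x, v x := by
    intro w v
    rw [Finset.sum_comm, Finset.sum_mul]
    refine Finset.sum_congr rfl fun i _ => ?_
    rw [← Finset.mul_sum]
    congr 1
    exact Equiv.sum_comp ((Equiv.addLeft i).trans e) v
  have := Finset.sum_le_sum fun (t : Fin n) (_ : t ∈ Finset.univ) =>
    h ((Equiv.addRight t).trans e)
  rw [rot, Finset.sum_add_distrib, rot] at this
  simpa using this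

theorem sum_fin_ite_lt {n f : ℕ} (hf : f ≤ n) :
    ∑ i : Fin n, (if (i : ℕ) < f then (1 : ℝ) else 0) = f := by
  rw [Fin.sum_univ_eq_sum_range (fun i => if i < f then (1 : ℝ) else 0) n, Finset.sum_boole]
  congr 1
  rw [show (Finset.range n).filter (fun i => i < f) = Finset.range f by
    ext x; simp; omega, Finset.card_range]

/-! ### The entropy inequalities of a conversion procedure -/

/-- The information-theoretic content of a conversion of a systematic MDS code, with a uniformly
random message from `Ω`.  The message consists of blocks indexed by `ι`, divided into the stripes
`stripe p` of size `k`; the other initial nodes (parity nodes) are indexed by `κ`. Every random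
variable is represented by the partition of `Ω` into its level sets, and `L` is the entropy
of a block. The new nodes of a final codeword are represented only through their contents; `t` is
the number of message blocks of a stripe that they can make up for, that is, the smaller one of `k`
and the number of parities of a final codeword. -/
structure ReadSystem (Ω ι κ π : Type*) [Fintype Ω] [Fintype ι] [Fintype κ] [Fintype π]
    [DecidableEq ι] (k t : ℕ) (L : ℝ) where
  /-- the message blocks in one final codeword -/
  stripe : π → Finset ι
  /-- a message block, which is also the contents of an information node -/
  block : ι → Setoid Ω
  /-- the data read from an information node -/
  readInfo : ι → Setoid Ω
  /-- the contents of a parity node -/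
  parity : κ → Setoid Ω
  /-- the data read from a parity node -/
  readParity : κ → Setoid Ω
  /-- the joint contents of the new nodes of a final codeword -/
  new : π → Setoid Ω
  t_le : t ≤ k
  card_stripe : ∀ p, (stripe p).card = k
  stripe_disjoint : ∀ p p', p ≠ p' → Disjoint (stripe p) (stripe p')
  exists_stripe : ∀ i, ∃ p, i ∈ stripe p
  block_le : ∀ i, block i ≤ readInfo i
  parity_le : ∀ j, parity j ≤ readParity j
  entropy_block_le : ∀ i, partitionEntropy (block i) ≤ L
  entropy_parity_le : ∀ j, partitionEntropy (parity j) ≤ L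
  inf_block : Finset.univ.inf block = ⊥
  entropy_bot : partitionEntropy (⊥ : Setoid Ω) = Fintype.card ι * L
  /-- the MDS property of the initial code, for sets that contain all parity nodes -/
  decode_initial : ∀ A : Finset ι, A.card + Fintype.card κ = Fintype.card ι →
    Finset.univ.inf parity ⊓ A.inf block = ⊥
  new_of_stripe : ∀ p, (stripe p).inf block ≤ new p
  /-- the new nodes are computed from the data read -/
  new_of_read : ∀ p, Finset.univ.inf readInfo ⊓ Finset.univ.inf readParity ≤ new p
  /-- the new nodes and `k - t` blocks of a stripe determine the stripe, since the final code is
  MDS -/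
  decode_final : ∀ p, ∀ V ⊆ stripe p, V.card + t = k →
    new p ⊓ V.inf block ≤ (stripe p).inf block

namespace ReadSystem

variable {Ω ι κ π : Type*} [Fintype Ω] [Fintype ι] [Fintype κ] [Fintype π]
  [DecidableEq ι] {k t : ℕ} {L : ℝ} (Z : ReadSystem Ω ι κ π k t L)

/-- The entropy of the data read from an information node. -/
noncomputable def infoCost (i : ι) : ℝ := partitionEntropy (Z.readInfo i)

/-- The entropy of the data read from a parity node. -/
noncomputable def parityCost (j : κ) : ℝ := partitionEntropy (Z.readParity j)

/-- The total entropy of the data read from the information nodes of a stripe. -/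
noncomputable def stripeCost (p : π) : ℝ := ∑ i ∈ Z.stripe p, Z.infoCost i

/-- What the new nodes of a stripe contain, together with what is read from its information
nodes. -/
noncomputable def known (p : π) : Setoid Ω := Z.new p ⊓ (Z.stripe p).inf Z.readInfo

/-- The entropy that the new nodes of a stripe add to the data read from its information
nodes. -/
noncomputable def newEntropy (p : π) : ℝ := partitionEntropy (Z.known p) - Z.stripeCost p

theorem entropy_inf_block_le (A : Finset ι) :
    partitionEntropy (A.inf Z.block) ≤ A.card * L := by
  refine (partitionEntropy_finset_inf_le A Z.block).trans ?_
  rw [← nsmul_eq_mul]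
  exact Finset.sum_le_card_nsmul A _ L fun i _ => Z.entropy_block_le i

theorem entropy_inf_block (A : Finset ι) : partitionEntropy (A.inf Z.block) = A.card * L := by
  refine le_antisymm (Z.entropy_inf_block_le A) ?_
  have h1 := partitionEntropy_inf_le (A.inf Z.block) (Aᶜ.inf Z.block)
  rw [← Finset.inf_union, Finset.union_compl, Z.inf_block, Z.entropy_bot] at h1
  have h2 := Z.entropy_inf_block_le Aᶜ
  rw [← Finset.card_add_card_compl A, Nat.cast_add] at h1
  linarith

theorem sum_entropy_le_of_block_le (A : Finset ι) {y : ι → Setoid Ω}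
    (hy : ∀ i ∈ A, Z.block i ≤ y i) :
    ∑ i ∈ A, partitionEntropy (y i) ≤ partitionEntropy (A.inf y) := by
  refine sum_partitionEntropy_le_of_le A hy ?_
  rw [Z.entropy_inf_block, ← nsmul_eq_mul]
  exact Finset.sum_le_card_nsmul A _ L fun i _ => Z.entropy_block_le i

theorem sum_infoCost_le (A : Finset ι) :
    ∑ i ∈ A, Z.infoCost i ≤ partitionEntropy (A.inf Z.readInfo) :=
  Z.sum_entropy_le_of_block_le A fun i _ => Z.block_le i

theorem entropy_block (i : ι) : partitionEntropy (Z.block i) = L := by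
  simpa using Z.entropy_inf_block {i}

theorem stripe_pairwiseDisjoint (Q : Set π) : Q.PairwiseDisjoint Z.stripe :=
  fun p _ p' _ h => Z.stripe_disjoint p p' h

theorem biUnion_stripe : Finset.univ.biUnion Z.stripe = Finset.univ := by
  ext i
  simpa using Z.exists_stripe i

theorem card_biUnion_stripe (Q : Finset π) : (Q.biUnion Z.stripe).card = Q.card * k := by
  rw [Finset.card_biUnion fun p _ p' _ h => Z.stripe_disjoint p p' h]
  simp [Z.card_stripe]

theorem card_index (Z : ReadSystem Ω ι κ π k t L) : Fintype.card ι = Fintype.card π * k := by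
  rw [← Finset.card_univ, ← Z.biUnion_stripe, Z.card_biUnion_stripe, Finset.card_univ]

theorem sum_biUnion_infoCost (Q : Finset π) :
    ∑ i ∈ Q.biUnion Z.stripe, Z.infoCost i = ∑ p ∈ Q, Z.stripeCost p :=
  Finset.sum_biUnion (Z.stripe_pairwiseDisjoint _)

theorem sum_infoCost : ∑ i, Z.infoCost i = ∑ p, Z.stripeCost p := by
  rw [← Z.sum_biUnion_infoCost, Z.biUnion_stripe]

theorem inf_block_le_known (p : π) : (Z.stripe p).inf Z.block ≤ Z.known p :=
  le_inf (Z.new_of_stripe p) (Finset.inf_mono_fun fun i _ => Z.block_le i)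

theorem inf_inf_stripe (y : ι → Setoid Ω) :
    Finset.univ.inf (fun p => (Z.stripe p).inf y) = Finset.univ.inf y := by
  rw [← Z.biUnion_stripe, Finset.inf_biUnion]

/-- The stripes are independent. -/
theorem sum_entropy_known_le :
    ∑ p, partitionEntropy (Z.known p) ≤ partitionEntropy (Finset.univ.inf Z.known) := by
  refine sum_partitionEntropy_le_of_le Finset.univ (fun p _ => Z.inf_block_le_known p) ?_
  rw [Z.inf_inf_stripe, Z.inf_block, Z.entropy_bot, Z.card_index]
  simp only [Z.entropy_inf_block, Z.card_stripe, Finset.sum_const, Finset.card_univ,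
    nsmul_eq_mul, Nat.cast_mul, mul_assoc, le_refl]

theorem read_le_inf_known :
    Finset.univ.inf Z.readParity ⊓ Finset.univ.inf Z.readInfo ≤ Finset.univ.inf Z.known := by
  refine Finset.le_inf fun p _ => le_inf ?_ ?_
  · rw [inf_comm]
    exact Z.new_of_read p
  · exact inf_le_right.trans (Finset.inf_mono (Finset.subset_univ _))

/-- Everything that the new nodes need beyond the data read from the information nodes comes
from the parity nodes. -/
theorem sum_newEntropy_le : ∑ p, Z.newEntropy p ≤ ∑ j, Z.parityCost j := by
  have h1 := Z.sum_entropy_known_le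
  have h2 := partitionEntropy_anti Z.read_le_inf_known
  have h3 := partitionEntropy_inf_le (Finset.univ.inf Z.readParity) (Finset.univ.inf Z.readInfo)
  have h4 := partitionEntropy_finset_inf_le Finset.univ Z.readInfo
  have h5 := partitionEntropy_finset_inf_le Finset.univ Z.readParity
  have h6 := Z.sum_infoCost
  unfold newEntropy
  rw [Finset.sum_sub_distrib]
  simp only [infoCost, parityCost] at *
  linarith

theorem parityCost_le (j : κ) : Z.parityCost j ≤ L :=
  (partitionEntropy_anti (Z.parity_le j)).trans (Z.entropy_parity_le j)

theorem sum_parityCost_le : ∑ j, Z.parityCost j ≤ Fintype.card κ * L := by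
  rw [← Finset.card_univ, ← nsmul_eq_mul]
  exact Finset.sum_le_card_nsmul _ _ L fun j _ => Z.parityCost_le j

/-- The new nodes of a stripe and `k - t` of its information nodes determine the stripe. -/
theorem newEntropy_ge (p : π) : (t : ℝ) * (k * L - Z.stripeCost p) ≤ k * Z.newEntropy p := by
  obtain ⟨V, hV, hVc, hle⟩ := exists_subset_card_mul_sum_le Z.infoCost (Z.stripe p) (k - t)
    (by rw [Z.card_stripe]; exact Nat.sub_le _ _)
  have ht := Z.t_le
  have h1 := partitionEntropy_submodular (a := Z.known p) (b := V.inf Z.block)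
    (c := V.inf Z.readInfo) (inf_le_right.trans (Finset.inf_mono hV))
    (Finset.inf_mono_fun fun i _ => Z.block_le i)
  have h2 : Z.known p ⊓ V.inf Z.block ≤ (Z.stripe p).inf Z.block :=
    (inf_le_inf_right _ inf_le_left).trans (Z.decode_final p V hV (by omega))
  have h3 := partitionEntropy_anti h2
  have h4 := Z.sum_infoCost_le V
  rw [Z.entropy_inf_block, Z.card_stripe] at h3
  rw [Z.entropy_inf_block, hVc, Nat.cast_sub ht] at h1
  rw [Z.card_stripe, Nat.cast_sub ht] at hle
  change _ * Z.stripeCost p ≤ _ at hle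
  unfold newEntropy
  have hk : (0 : ℝ) ≤ k := Nat.cast_nonneg k
  have h5 := mul_le_mul_of_nonneg_left
    (by linarith : k * L + ∑ i ∈ V, Z.infoCost i ≤ partitionEntropy (Z.known p) + (k - t) * L) hk
  linarith

/-- The key inequality, which bounds how much of the data read from the parity nodes is of use.
A set `T` of information nodes of the same size as the set of parity nodes has, given the other
information nodes, contents equivalent to those of the parity nodes.  So the data read from the
parity nodes are independent of the blocks outside `T`, and can reveal nothing about the blocks
in `A` except by means of data read from `T`. -/
theorem sum_entropy_known_add_le (T A : Finset ι) (hT : T.card = Fintype.card κ)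
    (hTA : Disjoint T A) (Q : Finset π) (hA : A ⊆ Q.biUnion Z.stripe) :
    ∑ p ∈ Q, partitionEntropy (Z.known p) + A.card * L ≤
      ∑ i ∈ T ∪ A, Z.infoCost i + Q.card * (k * L) := by
  classical
  set E := Finset.univ.inf Z.readParity with hE
  set D := Finset.univ.inf Z.readInfo with hD
  set y : ι → Setoid Ω := fun i => if i ∈ A then Z.block i else Z.readInfo i with hy
  have hby : ∀ i, Z.block i ≤ y i := by
    intro i
    by_cases hi : i ∈ A
    · simp [hy, hi]
    · simpa [hy, hi] using Z.block_le i
  have hyD : A.inf Z.block ⊓ D ≤ Tᶜ.inf y := by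
    refine Finset.le_inf fun i _ => ?_
    by_cases hi : i ∈ A
    · simpa [hy, hi] using inf_le_of_left_le (Finset.inf_le (f := Z.block) hi)
    · simpa [hy, hi] using inf_le_of_right_le (Finset.inf_le (f := Z.readInfo) (Finset.mem_univ i))
  -- the data read from the parity nodes are independent of everything outside `T`
  have hind : partitionEntropy E + partitionEntropy (Tᶜ.inf y) ≤
      partitionEntropy (E ⊓ Tᶜ.inf y) := by
    have h1 := partitionEntropy_mutual_mono
      (Finset.inf_mono_fun fun j _ => Z.parity_le j : Finset.univ.inf Z.parity ≤ E)
      (Finset.inf_mono_fun fun i _ => hby i : Tᶜ.inf Z.block ≤ Tᶜ.inf y)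
    have hc := Finset.card_add_card_compl T
    rw [Z.decode_initial Tᶜ (by omega), Z.entropy_bot, Z.entropy_inf_block, ← hc,
      Nat.cast_add] at h1
    have h2 : partitionEntropy (Finset.univ.inf Z.parity) ≤ T.card * L := by
      refine (partitionEntropy_finset_inf_le _ _).trans ?_
      rw [hT, ← Finset.card_univ, ← nsmul_eq_mul]
      exact Finset.sum_le_card_nsmul _ _ L fun j _ => Z.entropy_parity_le j
    linarith
  have hysum : A.card * L + ∑ i ∈ Tᶜ \ A, Z.infoCost i ≤ partitionEntropy (Tᶜ.inf y) := by
    refine le_trans (le_of_eq ?_) (Z.sum_entropy_le_of_block_le Tᶜ fun i _ => hby i)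
    have hAT : A ⊆ Tᶜ := by
      intro i hi
      rw [Finset.mem_compl]
      exact fun h => Finset.disjoint_left.1 hTA h hi
    rw [← Finset.sum_sdiff hAT, add_comm]
    congr 1
    · refine Finset.sum_congr rfl fun i hi => ?_
      simp [hy, (Finset.mem_sdiff.1 hi).2, infoCost]
    · rw [Finset.sum_congr rfl (g := fun _ => L) fun i hi => by simp [hy, hi, Z.entropy_block]]
      simp
  have hsub := partitionEntropy_submodular (a := E ⊓ D)
    (b := Finset.univ.inf Z.known ⊓ A.inf Z.block) (c := Finset.univ.inf Z.known)
    Z.read_le_inf_known inf_le_left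
  have hmeet : partitionEntropy (E ⊓ Tᶜ.inf y) ≤
      partitionEntropy (E ⊓ D ⊓ (Finset.univ.inf Z.known ⊓ A.inf Z.block)) := by
    refine partitionEntropy_anti (le_inf (inf_le_left.trans inf_le_left) (le_trans ?_ hyD))
    exact le_inf (inf_le_right.trans inf_le_right) (inf_le_left.trans inf_le_right)
  have hED : partitionEntropy (E ⊓ D) ≤ partitionEntropy E + ∑ i, Z.infoCost i :=
    (partitionEntropy_inf_le E D).trans
      (add_le_add_right (partitionEntropy_finset_inf_le _ _) _)
  -- given the new nodes, the blocks in `A` can be uncovered stripe by stripe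
  have hrev : partitionEntropy (Finset.univ.inf Z.known ⊓ A.inf Z.block) ≤
      ∑ p ∈ Qᶜ, partitionEntropy (Z.known p) + Q.card * (k * L) := by
    have hle : Qᶜ.inf Z.known ⊓ (Q.biUnion Z.stripe).inf Z.block ≤
        Finset.univ.inf Z.known ⊓ A.inf Z.block := by
      refine le_inf ?_ (inf_le_right.trans (Finset.inf_mono hA))
      refine Finset.le_inf fun p _ => ?_
      by_cases hp : p ∈ Q
      · refine inf_le_right.trans (le_trans ?_ (Z.inf_block_le_known p))
        exact Finset.inf_mono (Finset.subset_biUnion_of_mem Z.stripe hp)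
      · exact inf_le_left.trans (Finset.inf_le (Finset.mem_compl.2 hp))
    refine (partitionEntropy_anti hle).trans ((partitionEntropy_inf_le _ _).trans ?_)
    refine add_le_add (partitionEntropy_finset_inf_le _ _) ?_
    rw [Z.entropy_inf_block, Z.card_biUnion_stripe, Nat.cast_mul, mul_assoc]
  have hsplit := Finset.sum_add_sum_compl Q fun p => partitionEntropy (Z.known p)
  have hsplit' : ∑ i, Z.infoCost i = ∑ i ∈ T ∪ A, Z.infoCost i + ∑ i ∈ Tᶜ \ A, Z.infoCost i := by
    rw [← Finset.sum_add_sum_compl (T ∪ A), Finset.compl_union, Finset.sdiff_eq_inter_compl]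
  linarith [Z.sum_entropy_known_le]

/-! ### Bounds on the total cost -/

/-- The total entropy of the data read. -/
noncomputable def cost : ℝ := ∑ i, Z.infoCost i + ∑ j, Z.parityCost j

theorem sum_stripeCost_add_sum_newEntropy_le_cost :
    ∑ p, Z.stripeCost p + ∑ p, Z.newEntropy p ≤ Z.cost := by
  rw [cost, Z.sum_infoCost]
  linarith [Z.sum_newEntropy_le]

theorem sum_newEntropy_ge :
    (t : ℝ) * (Fintype.card π * (k * L) - ∑ p, Z.stripeCost p) ≤ k * ∑ p, Z.newEntropy p := by
  have := Finset.sum_le_sum fun p (_ : p ∈ Finset.univ) => Z.newEntropy_ge p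
  rw [← Finset.mul_sum, ← Finset.mul_sum, Finset.sum_sub_distrib] at this
  simpa using this

theorem sum_newEntropy_le_of_subset (Q : Finset π) (T A : Finset ι)
    (hT : T.card = Fintype.card κ) (hTA : Disjoint T A) (hA : A ⊆ Q.biUnion Z.stripe) :
    ∑ p ∈ Q, Z.newEntropy p ≤ ∑ i ∈ T ∪ A, Z.infoCost i - ∑ p ∈ Q, Z.stripeCost p +
      (Q.card * k - A.card) * L := by
  have h := Z.sum_entropy_known_add_le T A hT hTA Q hA
  unfold newEntropy
  rw [Finset.sum_sub_distrib]
  linarith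

/-- With `|κ| = f * k + b`: the sets `T` consisting of `f` stripes and `b` nodes of
another stripe bound the new data in the remaining stripes. -/
theorem sum_newEntropy_le_of_lt (hk : 0 < k) {f b : ℕ} (hs : Fintype.card κ = f * k + b)
    (hb : b ≤ k) (hf : f < Fintype.card π) :
    ((Fintype.card π : ℝ) - f - 1) * ∑ p, Z.newEntropy p ≤
      (f + b / k : ℝ) * ∑ p, Z.stripeCost p := by
  classical
  have hk' : (0 : ℝ) < k := by exact_mod_cast hk
  have key := sum_mul_sum_le_of_forall_equiv (n := Fintype.card π) (by omega)
    (Fintype.equivFin π).symm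
    (fun i => if (i : ℕ) < f + 1 then 0 else 1)
    (fun i => (if (i : ℕ) < f then 1 else 0) + if (i : ℕ) = f then (b / k : ℝ) else 0)
    Z.newEntropy Z.stripeCost 0 ?_
  · have e1 : ∑ i : Fin (Fintype.card π), (if (i : ℕ) < f + 1 then (0 : ℝ) else 1) =
        (Fintype.card π : ℝ) - f - 1 := by
      have h1 := sum_fin_ite_lt (n := Fintype.card π) (f := f + 1) (by omega)
      have h2 : ∑ i : Fin (Fintype.card π), ((if (i : ℕ) < f + 1 then (0 : ℝ) else 1) +
          if (i : ℕ) < f + 1 then (1 : ℝ) else 0) = Fintype.card π := by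
        rw [Finset.sum_congr rfl (g := fun _ => (1 : ℝ)) fun i _ => by split_ifs <;> simp]
        simp
      rw [Finset.sum_add_distrib, h1] at h2
      push_cast at h2
      linarith
    have e2 : ∑ i : Fin (Fintype.card π), (if (i : ℕ) = f then (b / k : ℝ) else 0) = b / k := by
      rw [Finset.sum_eq_single (⟨f, hf⟩ : Fin (Fintype.card π))]
      · simp
      · intro i _ hi
        rw [if_neg fun h => hi (Fin.ext h)]
      · simp
    rw [e1, Finset.sum_add_distrib, sum_fin_ite_lt hf.le, e2, mul_zero, add_zero] at key
    exact key
  · intro σ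
    obtain ⟨V, hV, hVc, hle⟩ := exists_subset_card_mul_sum_le (fun i => -Z.infoCost i)
      (Z.stripe (σ ⟨f, hf⟩)) b (by rw [Z.card_stripe]; exact hb)
    set F : Finset π := (Finset.univ.filter fun i : Fin (Fintype.card π) => (i : ℕ) < f).map
      σ.toEmbedding with hF
    set Q : Finset π := (Finset.univ.filter fun i : Fin (Fintype.card π) => ¬ (i : ℕ) < f + 1).map
      σ.toEmbedding with hQ
    have hFcard : F.card = f := by
      rw [hF, Finset.card_map]
      have := sum_fin_ite_lt (n := Fintype.card π) (f := f) hf.le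
      rw [Finset.sum_boole] at this
      exact_mod_cast this
    have hdisjF : Disjoint (F.biUnion Z.stripe) V := by
      rw [Finset.disjoint_biUnion_left]
      intro p hp
      refine Finset.disjoint_of_subset_right hV (Z.stripe_disjoint _ _ ?_)
      rintro rfl
      simp [hF] at hp
    have hdisjQ : Disjoint (F.biUnion Z.stripe ∪ V) (Q.biUnion Z.stripe) := by
      rw [Finset.disjoint_biUnion_right]
      intro p hp
      rw [hQ, Finset.mem_map_equiv, Finset.mem_filter] at hp
      rw [Finset.disjoint_union_left, Finset.disjoint_biUnion_left]
      constructor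
      · intro p' hp'
        rw [hF, Finset.mem_map_equiv, Finset.mem_filter] at hp'
        refine Z.stripe_disjoint _ _ ?_
        rintro rfl
        omega
      · refine Finset.disjoint_of_subset_left hV (Z.stripe_disjoint _ _ ?_)
        rintro rfl
        simp at hp
    have hTcard : (F.biUnion Z.stripe ∪ V).card = Fintype.card κ := by
      rw [Finset.card_union_of_disjoint hdisjF, Z.card_biUnion_stripe, hFcard, hVc, hs]
    have h := Z.sum_newEntropy_le_of_subset Q (F.biUnion Z.stripe ∪ V) (Q.biUnion Z.stripe)
      hTcard hdisjQ (Finset.Subset.refl _)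
    rw [Finset.sum_union hdisjQ, Finset.sum_union hdisjF, Z.sum_biUnion_infoCost,
      Z.sum_biUnion_infoCost, Z.card_biUnion_stripe, Nat.cast_mul, sub_self, zero_mul,
      add_zero, add_sub_cancel_right, hQ, hF, Finset.sum_map, Finset.sum_map,
      Finset.sum_filter, Finset.sum_filter] at h
    rw [add_zero]
    have hVle : ∑ i ∈ V, Z.infoCost i ≤ b / k * Z.stripeCost (σ ⟨f, hf⟩) := by
      rw [Z.card_stripe, Finset.sum_neg_distrib, Finset.sum_neg_distrib] at hle
      rw [div_mul_eq_mul_div, le_div_iff₀ hk']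
      unfold stripeCost
      linarith
    have e3 : ∑ i : Fin (Fintype.card π), (if (i : ℕ) = f then (b / k : ℝ) else 0) *
        Z.stripeCost (σ i) = b / k * Z.stripeCost (σ ⟨f, hf⟩) := by
      rw [Finset.sum_eq_single (⟨f, hf⟩ : Fin (Fintype.card π))]
      · simp
      · intro i _ hi
        rw [if_neg fun h => hi (Fin.ext h), zero_mul]
      · simp
    simp only [add_mul, Finset.sum_add_distrib, e3]
    simp only [ite_mul, one_mul, zero_mul]
    simp only [ite_not, Equiv.coe_toEmbedding] at h
    linarith

/-- With `|κ| = f * k + b`: the sets `T` containing `f` stripes bound the new data in the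
remaining stripes. -/
theorem sum_newEntropy_le_of_le {f b : ℕ} (hs : Fintype.card κ = f * k + b)
    (hle : Fintype.card κ ≤ Fintype.card ι) (hπ : 0 < Fintype.card π)
    (hf : f ≤ Fintype.card π) :
    ((Fintype.card π : ℝ) - f) * ∑ p, Z.newEntropy p ≤
      f * ∑ p, Z.stripeCost p + Fintype.card π * (b * L) := by
  classical
  have key := sum_mul_sum_le_of_forall_equiv (n := Fintype.card π) hπ
    (Fintype.equivFin π).symm
    (fun i => if (i : ℕ) < f then 0 else 1)
    (fun i => if (i : ℕ) < f then 1 else 0)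
    Z.newEntropy Z.stripeCost (b * L) ?_
  · have e1 : ∑ i : Fin (Fintype.card π), (if (i : ℕ) < f then (0 : ℝ) else 1) =
        (Fintype.card π : ℝ) - f := by
      have h2 : ∑ i : Fin (Fintype.card π), ((if (i : ℕ) < f then (0 : ℝ) else 1) +
          if (i : ℕ) < f then (1 : ℝ) else 0) = Fintype.card π := by
        rw [Finset.sum_congr rfl (g := fun _ => (1 : ℝ)) fun i _ => by split_ifs <;> simp]
        simp
      rw [Finset.sum_add_distrib, sum_fin_ite_lt hf] at h2
      linarith
    rw [e1, sum_fin_ite_lt hf] at key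
    exact key
  · intro σ
    set F : Finset π := (Finset.univ.filter fun i : Fin (Fintype.card π) => (i : ℕ) < f).map
      σ.toEmbedding with hF
    have hFcard : F.card = f := by
      rw [hF, Finset.card_map]
      have := sum_fin_ite_lt (n := Fintype.card π) (f := f) hf
      rw [Finset.sum_boole] at this
      exact_mod_cast this
    obtain ⟨T, hFT, -, hTc⟩ := Finset.exists_subsuperset_card_eq
      (Finset.subset_univ (F.biUnion Z.stripe)) (n := Fintype.card κ)
      (by rw [Z.card_biUnion_stripe, hFcard]; omega) (by rw [Finset.card_univ]; exact hle)
    have hA : Tᶜ ⊆ Fᶜ.biUnion Z.stripe := by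
      intro i hi
      obtain ⟨p, hp⟩ := Z.exists_stripe i
      refine Finset.mem_biUnion.2 ⟨p, Finset.mem_compl.2 fun hpF => ?_, hp⟩
      exact Finset.mem_compl.1 hi (hFT (Finset.mem_biUnion.2 ⟨p, hpF, hp⟩))
    have h := Z.sum_newEntropy_le_of_subset Fᶜ T Tᶜ hTc disjoint_compl_right hA
    have hc : ((Fᶜ).card * k - (Tᶜ).card : ℝ) = b := by
      have h1 := Finset.card_add_card_compl F
      have h2 := Finset.card_add_card_compl T
      rw [Z.card_index, hTc, hs] at h2
      rw [hFcard] at h1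
      rw [← h1] at h2
      have h2' : ((f * k + b + (Tᶜ).card : ℕ) : ℝ) = ((f + (Fᶜ).card) * k : ℕ) := by rw [h2]
      push_cast at h2'
      linarith
    rw [Finset.union_compl, Z.sum_infoCost, ← Finset.sum_add_sum_compl F Z.stripeCost,
      add_sub_cancel_right, hc] at h
    have hFc : Fᶜ = (Finset.univ.filter fun i : Fin (Fintype.card π) => ¬ (i : ℕ) < f).map
        σ.toEmbedding := by
      ext p
      simp [hF, Finset.mem_map_equiv]
    rw [hFc, hF, Finset.sum_map, Finset.sum_map, Finset.sum_filter, Finset.sum_filter] at h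
    simp only [ite_not, Equiv.coe_toEmbedding] at h
    simpa only [ite_mul, one_mul, zero_mul] using h

theorem cost_ge_min (hk : 0 < k) : (Fintype.card π : ℝ) * t * L ≤ Z.cost := by
  have h0 := Z.sum_stripeCost_add_sum_newEntropy_le_cost
  have h1 := Z.sum_newEntropy_ge
  have hk' : (0 : ℝ) < k := by exact_mod_cast hk
  have htk : (t : ℝ) ≤ k := by exact_mod_cast Z.t_le
  have hd : 0 ≤ ∑ p, Z.stripeCost p := Finset.sum_nonneg fun p _ => Finset.sum_nonneg fun i _ =>
    partitionEntropy_top (Ω := Ω) ▸ partitionEntropy_anti le_top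
  have h2 := mul_nonneg (sub_nonneg.2 htk) hd
  refine le_trans (le_of_mul_le_mul_left ?_ hk') h0
  linarith

/-- The bound resulting from `sum_newEntropy_ge` if nothing is known of the data read from the
parity nodes except the size of these nodes. -/
theorem cost_ge_of_parity (ht : 0 < t) :
    (Fintype.card π : ℝ) * k * L - Fintype.card κ * L * (k / t - 1) ≤ Z.cost := by
  have ht' : (0 : ℝ) < t := by exact_mod_cast ht
  have htk : (t : ℝ) ≤ k := by exact_mod_cast Z.t_le
  have h1 := Z.sum_newEntropy_ge
  have h2 := Z.sum_newEntropy_le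
  have h3 := Z.sum_parityCost_le
  rw [cost, Z.sum_infoCost]
  have e : (k / t - 1 : ℝ) = (k - t) / t := by field_simp
  rw [e, ← mul_div_assoc, sub_le_iff_le_add, ← sub_le_iff_le_add', le_div_iff₀ ht']
  have h4 := mul_le_mul_of_nonneg_right h3 (sub_nonneg.2 htk)
  have h5 := mul_le_mul_of_nonneg_left h2 (ht'.le.trans htk)
  linarith

/-- The bound resulting from a bound of the new data by the data read from the information
nodes. -/
theorem cost_ge_of_newEntropy_le {θ : ℝ} (hk : 0 < k) (hθ : 0 ≤ θ)
    (h : θ * ∑ p, Z.newEntropy p ≤ Fintype.card κ / k * ∑ p, Z.stripeCost p)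
    (hpos : 0 < θ * t + Fintype.card κ) :
    (Fintype.card π : ℝ) * t * L * ((θ * k + Fintype.card κ) / (θ * t + Fintype.card κ)) ≤
      Z.cost := by
  have hk' : (0 : ℝ) < k := by exact_mod_cast hk
  have htk : (t : ℝ) ≤ k := by exact_mod_cast Z.t_le
  have h0 := Z.sum_stripeCost_add_sum_newEntropy_le_cost
  have h1 := Z.sum_newEntropy_ge
  refine le_trans ?_ h0
  set U := ∑ p, Z.newEntropy p
  set d := ∑ p, Z.stripeCost p
  set s : ℝ := (Fintype.card κ : ℝ)
  rw [div_mul_eq_mul_div, le_div_iff₀ hk'] at h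
  rw [← mul_div_assoc, div_le_iff₀ hpos]
  have hs : (0 : ℝ) ≤ s := Nat.cast_nonneg _
  have h2 := mul_le_mul_of_nonneg_left h1 (by positivity : 0 ≤ θ * k + s)
  have h3 := mul_le_mul_of_nonneg_left h (sub_nonneg.2 htk)
  refine le_of_mul_le_mul_left ?_ hk'
  nlinarith

end ReadSystem

/-! ### The four cases of the lower bound -/

namespace ReadSystem

variable {Ω ι κ π : Type*} [Fintype Ω] [Fintype ι] [Fintype κ] [Fintype π] [DecidableEq ι]

/-- The bound for a read system with blocks of entropy `α * c`; for a code over `F` the factor `c`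
converts from nats to symbols of `F`. -/
theorem splitBound_mul_le_cost {lam kF rI rF α : ℕ} {c : ℝ} (hkF : 1 ≤ kF)
    (hrF : 1 ≤ rF) (hlam : 1 ≤ lam) (Z : ReadSystem Ω ι κ π kF (min kF rF) (α * c))
    (hπ : Fintype.card π = lam) (hκ : Fintype.card κ = rI) :
    splitBound lam kF rI rF α * c ≤ Z.cost := by
  have hk' : (0 : ℝ) < kF := by exact_mod_cast hkF
  have hr' : (0 : ℝ) < rF := by exact_mod_cast hrF
  set f := rI / kF with hf
  set b := rI % kF with hb
  have hs : rI = f * kF + b := by rw [mul_comm]; exact (Nat.div_add_mod rI kF).symm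
  have hbk : b < kF := Nat.mod_lt _ (by omega)
  have hsR : (rI : ℝ) = f * kF + b := by exact_mod_cast hs
  have hdiv : (rI : ℝ) / kF = f + b / kF := by rw [hsR]; field_simp
  have hb0 : (0 : ℝ) ≤ b := Nat.cast_nonneg b
  have hbk' : (b : ℝ) / kF < 1 := by
    rw [div_lt_one hk']
    exact_mod_cast hbk
  have hι := Z.card_index
  rw [hπ] at hι
  unfold splitBound
  split_ifs with h1 h2 h3
  · obtain ⟨hrs, hsl, hrk, hbr⟩ := h1
    have hmin : ((min kF rF : ℕ) : ℝ) = rF := by rw [min_eq_right hrk.le]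
    have hflam : f < lam := by
      by_contra hcon
      have := Nat.mul_le_mul_right kF (not_lt.1 hcon)
      omega
    have hceil : ⌈(rI : ℝ) / kF⌉ = (f : ℤ) + 1 := by
      rw [Int.ceil_eq_iff, hdiv]
      have : (0 : ℝ) < b / kF := div_pos (by exact_mod_cast (by omega : 0 < b)) hk'
      push_cast
      constructor <;> linarith
    have hθ : (0 : ℝ) ≤ (lam : ℝ) - f - 1 := by
      have : (f : ℝ) + 1 ≤ lam := by exact_mod_cast hflam
      linarith
    have hU := Z.sum_newEntropy_le_of_lt (by omega) (by rw [hκ]; exact hs) hbk.le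
      (by rw [hπ]; exact hflam)
    rw [hπ, ← hdiv, ← hκ] at hU
    have hpos : (0 : ℝ) < ((lam : ℝ) - f - 1) * (min kF rF : ℕ) + (Fintype.card κ : ℝ) := by
      have : (0 : ℝ) < Fintype.card κ := by rw [hκ]; exact_mod_cast (by omega : 0 < rI)
      positivity
    have key := Z.cost_ge_of_newEntropy_le (by omega) hθ hU hpos
    rw [hmin, hκ, hπ] at key
    rw [hceil]
    push_cast
    refine le_trans (le_of_eq ?_) key
    rw [← sub_sub]
    ring
  · obtain ⟨hrs, hsl, hrk, hbr⟩ := h2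
    have hmin : ((min kF rF : ℕ) : ℝ) = rF := by rw [min_eq_right hrk.le]
    have hflam : f ≤ lam := by
      by_contra hcon
      have := Nat.mul_le_mul_right kF (by omega : lam + 1 ≤ f)
      rw [Nat.add_mul] at this
      omega
    have hfloor : ⌊(rI : ℝ) / kF⌋ = (f : ℤ) := by
      rw [Int.floor_eq_iff, hdiv]
      have : (0 : ℝ) ≤ b / kF := by positivity
      push_cast
      constructor <;> linarith
    have hbr' : (b : ℝ) / rF < 1 := by
      rw [div_lt_one hr']
      exact_mod_cast hbr
    have hθ : (0 : ℝ) ≤ (lam : ℝ) - f - b / rF := by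
      rcases hflam.lt_or_eq with h | h
      · have : (f : ℝ) + 1 ≤ lam := by exact_mod_cast h
        linarith
      · have hb00 : b = 0 := by
          rw [h] at hs
          omega
        rw [hb00, h]
        simp
    have hU := Z.sum_newEntropy_le_of_le (by rw [hκ]; exact hs)
      (by rw [hκ, hι]; exact hsl) (by omega) (by rw [hπ]; exact hflam)
    -- the summand `lam * b * α * c` in `hU` is bounded by means of `sum_newEntropy_ge`, which turns
    -- the factor `lam - f` into `lam - f - b / rF`
    have hge := Z.sum_newEntropy_ge
    rw [hmin, hπ] at hge
    rw [hπ] at hU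
    have hU' : ((lam : ℝ) - f - b / rF) * ∑ p, Z.newEntropy p ≤
        Fintype.card κ / kF * ∑ p, Z.stripeCost p := by
      rw [hκ, hdiv]
      have h5 := mul_le_mul_of_nonneg_left hge (by positivity : (0 : ℝ) ≤ b / (rF * kF))
      have e1 : (b / (rF * kF) : ℝ) * (rF * (lam * (kF * (α * c)) - ∑ p, Z.stripeCost p)) =
          lam * (b * (α * c)) - b / kF * ∑ p, Z.stripeCost p := by
        field_simp
      have e2 : (b / (rF * kF) : ℝ) * (kF * ∑ p, Z.newEntropy p) =
          b / rF * ∑ p, Z.newEntropy p := by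
        field_simp
      rw [e1, e2] at h5
      linarith
    have hpos : (0 : ℝ) < ((lam : ℝ) - f - b / rF) * (min kF rF : ℕ) + (Fintype.card κ : ℝ) := by
      have : (0 : ℝ) < Fintype.card κ := by rw [hκ]; exact_mod_cast (by omega : 0 < rI)
      positivity
    have key := Z.cost_ge_of_newEntropy_le (by omega) hθ hU' hpos
    rw [hmin, hκ, hπ] at key
    rw [hmin, hκ] at hpos
    rw [hfloor]
    push_cast
    refine le_trans (le_of_eq ?_) key
    have hden : ((lam : ℝ) - f - b / rF) * rF + rI = (lam - f) * rF + f * kF := by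
      rw [hsR]
      field_simp
      ring
    rw [hden] at hpos ⊢
    obtain ⟨Q, hQ⟩ : ∃ Q : ℝ, Q = (lam - f) * rF + f * kF := ⟨_, rfl⟩
    rw [← hQ] at hpos ⊢
    have hQ0 := hpos.ne'
    rw [hsR]
    field_simp
    rw [hQ]
    ring
  · obtain ⟨hsr, hrk⟩ := h3
    have hmin : ((min kF rF : ℕ) : ℝ) = rF := by rw [min_eq_right hrk.le]
    have key := Z.cost_ge_of_parity (by omega)
    rw [hmin, hκ, hπ] at key
    refine le_trans (le_of_eq ?_) key
    ring
  · have key := Z.cost_ge_min (by omega)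
    rw [hπ] at key
    refine le_trans (le_of_eq ?_) key
    ring

end ReadSystem

theorem finset_inf_ker_rel {Ω ι : Type*} {S : ι → Type*} (A : Finset ι) (f : (i : ι) → Ω → S i)
    {m m' : Ω} : (A.inf fun i => Setoid.ker (f i)) m m' ↔ ∀ i ∈ A, f i m = f i m' := by
  classical
  induction A using Finset.induction_on with
  | empty => exact iff_of_true trivial (by simp)
  | insert i A hi ih =>
    rw [Finset.inf_insert, Finset.forall_mem_insert, ← ih]
    rfl

theorem sum_eq_sum_embedding_add {ι ν : Type*} [Fintype ι] [Fintype ν] (e : ι ↪ ν)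
    [Fintype {i // ¬ i ∈ Set.range e}] (g : ν → ℝ) :
    ∑ i, g i = ∑ j, g (e j) + ∑ i : {i // ¬ i ∈ Set.range e}, g i := by
  classical
  rw [← Finset.sum_add_sum_compl (Finset.univ.map e), Finset.sum_map]
  congr 1
  exact Finset.sum_subtype _ (by simp) g

/-! ### The read system of a convertible code -/

namespace SplitConvertibleCode

variable {F : Type*} {α nI kI nF kF : ℕ}

/-- The part of the message that belongs to the final codeword of `P`. -/
def submessage (Z : SplitConvertibleCode F α nI kI nF kF) (P : Z.partition.parts)
    (m : Fin kI → Block F α) : Fin kF → Block F α :=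
  fun j => m ((P : Finset (Fin kI)).orderEmbOfFin (Z.card_part P P.2) j)

theorem submessage_eq_iff (Z : SplitConvertibleCode F α nI kI nF kF) (P : Z.partition.parts)
    (m m' : Fin kI → Block F α) :
    Z.submessage P m = Z.submessage P m' ↔ ∀ i ∈ (P : Finset (Fin kI)), m i = m' i := by
  constructor
  · intro h i hi
    have : i ∈ Set.range ((P : Finset (Fin kI)).orderEmbOfFin (Z.card_part P P.2)) := by
      rw [Finset.range_orderEmbOfFin]
      exact hi
    obtain ⟨j, rfl⟩ := this
    exact congrFun h j
  · intro h
    funext j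
    exact h _ (Finset.orderEmbOfFin_mem _ _ _)

/-- In a systematic MDS initial code an unchanged node of a final codeword is one of its
information nodes: no other initial node is a function of the blocks of one stripe. -/
theorem exists_info_of_source (Z : SplitConvertibleCode F α nI kI nF kF) [Nontrivial F]
    (hα : 1 ≤ α) (hlt : kF < kI) (hMDS : Z.initial.IsMDS) {info : Fin kI ↪ Fin nI}
    (hinfo : Z.initial.IsSystematicAt info) {P : Z.partition.parts} {l : Fin nF} {i : Fin nI}
    (h : Z.source P l = some i) : ∃ j ∈ (P : Finset (Fin kI)), i = info j := by
  classical
  have hdep : ∀ m m' : Fin kI → Block F α, (∀ j ∈ (P : Finset (Fin kI)), m j = m' j) →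
      Z.initial.enc m i = Z.initial.enc m' i := by
    intro m m' hm
    have h1 := Z.unchanged_correct m P l i h
    have h2 := Z.unchanged_correct m' P l i h
    rw [← h1, ← h2]
    exact congrArg (fun x => Z.final.enc x l) ((Z.submessage_eq_iff P m m').2 hm)
  -- two messages that differ exactly in the block `j₀`
  obtain ⟨x, y, hxy⟩ := exists_pair_ne F
  have hm : ∀ j₀ : Fin kI, ∃ m m' : Fin kI → Block F α, m j₀ ≠ m' j₀ ∧
      ∀ j, j ≠ j₀ → m j = m' j := by
    intro j₀
    refine ⟨fun _ _ => x, Function.update (fun _ _ => x) j₀ fun _ => y, ?_, ?_⟩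
    · rw [Function.update_self]
      exact fun h => hxy (congrFun h ⟨0, hα⟩)
    · intro j hj
      rw [Function.update_of_ne hj]
  by_contra hcon
  push Not at hcon
  by_cases hi : ∃ j, i = info j
  · obtain ⟨j, rfl⟩ := hi
    have hjP : j ∉ (P : Finset (Fin kI)) := fun hj => hcon j hj rfl
    obtain ⟨m, m', hne, heq⟩ := hm j
    apply hne
    rw [← hinfo m j, ← hinfo m' j]
    exact hdep m m' fun j' hj' => heq j' fun e => hjP (e ▸ hj')
  · push Not at hi
    obtain ⟨j₀, hj₀⟩ : ∃ j₀, j₀ ∉ (P : Finset (Fin kI)) := by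
      by_contra hall
      push Not at hall
      have := Z.card_part P P.2
      rw [Finset.eq_univ_iff_forall.2 hall, Finset.card_univ, Fintype.card_fin] at this
      omega
    obtain ⟨m, m', hne, heq⟩ := hm j₀
    apply hne
    rw [hMDS (insert i ((Finset.univ.erase j₀).map info)) ?_ m m' ?_]
    · rw [Finset.card_insert_of_notMem, Finset.card_map, Finset.card_erase_of_mem
        (Finset.mem_univ _), Finset.card_univ, Fintype.card_fin]
      · omega
      · intro hmem
        obtain ⟨j, -, hj⟩ := Finset.mem_map.1 hmem
        exact hi j hj.symm
    · intro i' hi'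
      rcases Finset.mem_insert.1 hi' with rfl | hi'
      · exact hdep m m' fun j hj => heq j fun e => hj₀ (e ▸ hj)
      · obtain ⟨j, hj, rfl⟩ := Finset.mem_map.1 hi'
        rw [hinfo, hinfo]
        exact heq j (Finset.ne_of_mem_erase hj)

/-- At most `kF` nodes of a final codeword are unchanged, and these are information nodes; so the
new nodes together with sufficiently many message blocks comprise `kF` final nodes. -/
theorem new_nodes_decode (Z : SplitConvertibleCode F α nI kI nF kF) [Nontrivial F]
    (hα : 1 ≤ α) (hlt : kF < kI) (hMDS : Z.IsMDS) {info : Fin kI ↪ Fin nI}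
    (hinfo : Z.initial.IsSystematicAt info) (P : Z.partition.parts) (V : Finset (Fin kI))
    (hV : V ⊆ P) (hVc : kF + kF ≤ V.card + nF) (m m' : Fin kI → Block F α)
    (hnew : ∀ l, Z.source P l = none →
      Z.final.enc (Z.submessage P m) l = Z.final.enc (Z.submessage P m') l)
    (hmV : ∀ j ∈ V, m j = m' j) : Z.submessage P m = Z.submessage P m' := by
  classical
  -- the final nodes that are new or equal to a block in `V`
  set S : Finset (Fin nF) := Finset.univ.filter fun l =>
    Z.source P l = none ∨ ∃ j ∈ V, Z.source P l = some (info j) with hS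
  have hSc : ∀ l ∈ Sᶜ, ∃ j ∈ (P : Finset (Fin kI)) \ V, Z.source P l = some (info j) := by
    intro l hl
    rw [Finset.mem_compl, hS, Finset.mem_filter] at hl
    push Not at hl
    obtain ⟨h1, h2⟩ := hl (Finset.mem_univ _)
    obtain ⟨i, hi⟩ := Option.ne_none_iff_exists'.1 h1
    obtain ⟨j, hj, rfl⟩ := Z.exists_info_of_source hα hlt hMDS.1 hinfo hi
    exact ⟨j, Finset.mem_sdiff.2 ⟨hj, fun hjV => h2 j hjV hi⟩, hi⟩
  have hcard : (Sᶜ).card ≤ ((P : Finset (Fin kI)) \ V).card := by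
    choose g hg hg' using hSc
    rw [← Fintype.card_coe, ← Fintype.card_coe]
    refine Fintype.card_le_of_injective
      (fun l : {l // l ∈ Sᶜ} => (⟨g l.1 l.2, hg l.1 l.2⟩ : {j // j ∈ (P : Finset (Fin kI)) \ V})) ?_
    intro l l' hll
    have e := hg' l'.1 l'.2
    rw [← Subtype.mk.inj hll] at e
    exact Subtype.ext (Z.source_inj P P l.1 l'.1 _ (hg' l.1 l.2) e).2
  have h1 := Finset.card_add_card_compl S
  have h2 := Finset.card_sdiff_add_card_eq_card hV
  rw [Z.card_part P P.2] at h2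
  rw [Fintype.card_fin] at h1
  obtain ⟨S', hS', hS'c⟩ := Finset.exists_subset_card_eq (by omega : kF ≤ S.card)
  refine hMDS.2 S' hS'c _ _ fun l hl => ?_
  rcases (Finset.mem_filter.1 (hS' hl)).2 with h | ⟨j, hj, h⟩
  · exact hnew l h
  · have e1 := Z.unchanged_correct m P l _ h
    have e2 := Z.unchanged_correct m' P l _ h
    rw [hinfo] at e1 e2
    exact e1.trans ((hmV j hj).trans e2.symm)

/-- The read system of a systematic MDS convertible code. -/
noncomputable def readSystem [Field F] [Fintype F] {lam rI rF : ℕ}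
    (Z : SplitConvertibleCode F α (lam * kF + rI) (lam * kF) (kF + rF) kF)
    (hα : 1 ≤ α) (hlam : 2 ≤ lam) (hkF : 1 ≤ kF) (hMDS : Z.IsMDS)
    (info : Fin (lam * kF) ↪ Fin (lam * kF + rI)) (hinfo : Z.initial.IsSystematicAt info) :
    ReadSystem (Fin (lam * kF) → Block F α) (Fin (lam * kF))
      {i : Fin (lam * kF + rI) // ¬ i ∈ Set.range info} Z.partition.parts kF (min kF rF)
      (α * Real.log (Fintype.card F)) where
  stripe P := P
  block i := Setoid.ker fun m => m i
  readInfo i := Setoid.ker fun m => Z.read (info i) (Z.initial.enc m (info i))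
  parity j := Setoid.ker fun m => Z.initial.enc m j.1
  readParity j := Setoid.ker fun m => Z.read j.1 (Z.initial.enc m j.1)
  new P := Setoid.ker fun m (l : {l // Z.source P l = none}) =>
    Z.final.enc (Z.submessage P m) l.1
  t_le := min_le_left _ _
  card_stripe P := Z.card_part P P.2
  stripe_disjoint P P' h := Z.partition.disjoint P.2 P'.2 fun e => h (Subtype.ext e)
  exists_stripe i := by
    obtain ⟨P, hP, hi⟩ := Z.partition.exists_mem (Finset.mem_univ i)
    exact ⟨⟨P, hP⟩, hi⟩
  block_le i := by
    intro m m' h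
    simp only [Setoid.ker_def] at h ⊢
    rw [hinfo, hinfo, h]
  parity_le j := by
    intro m m' h
    simp only [Setoid.ker_def] at h ⊢
    rw [h]
  entropy_block_le i := by
    refine (partitionEntropy_ker_le_log_card _).trans (le_of_eq ?_)
    simp
  entropy_parity_le j := by
    refine (partitionEntropy_ker_le_log_card _).trans (le_of_eq ?_)
    simp
  inf_block := by
    refine le_bot_iff.1 fun m m' h => ?_
    rw [finset_inf_ker_rel] at h
    exact funext fun i => h i (Finset.mem_univ i)
  entropy_bot := by
    rw [partitionEntropy_bot]
    simp
  decode_initial A hA := by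
    classical
    refine le_bot_iff.1 fun m m' h => ?_
    obtain ⟨h1, h2⟩ := h
    rw [finset_inf_ker_rel] at h1 h2
    refine hMDS.1 (A.map info ∪ Finset.univ.filter fun i => ¬ i ∈ Set.range info) ?_ m m' ?_
    · rw [Finset.card_union_of_disjoint, Finset.card_map, ← Fintype.card_subtype, hA,
        Fintype.card_fin]
      rw [Finset.disjoint_left]
      intro i hi hi'
      obtain ⟨j, -, rfl⟩ := Finset.mem_map.1 hi
      exact (Finset.mem_filter.1 hi').2 ⟨j, rfl⟩
    · intro i hi
      rcases Finset.mem_union.1 hi with hi | hi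
      · obtain ⟨j, hj, rfl⟩ := Finset.mem_map.1 hi
        rw [hinfo, hinfo]
        exact h2 j hj
      · exact h1 ⟨i, (Finset.mem_filter.1 hi).2⟩ (Finset.mem_univ _)
  new_of_stripe P := by
    intro m m' h
    rw [finset_inf_ker_rel] at h
    rw [Setoid.ker_def, (Z.submessage_eq_iff P m m').2 h]
  new_of_read P := by
    intro m m' h
    obtain ⟨h1, h2⟩ := h
    rw [finset_inf_ker_rel] at h1 h2
    rw [Setoid.ker_def]
    funext ⟨l, hl⟩
    have e1 := Z.new_correct m P l hl
    have e2 := Z.new_correct m' P l hl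
    refine e1.trans (Eq.trans ?_ e2.symm)
    congr 1
    funext i
    by_cases hi : i ∈ Set.range info
    · obtain ⟨j, rfl⟩ := hi
      exact h1 j (Finset.mem_univ _)
    · exact h2 ⟨i, hi⟩ (Finset.mem_univ _)
  decode_final P V hV hVc := by
    intro m m' h
    obtain ⟨h1, h2⟩ := h
    rw [finset_inf_ker_rel] at h2 ⊢
    rw [Setoid.ker_def] at h1
    refine (Z.submessage_eq_iff P m m').1 (Z.new_nodes_decode hα ?_ hMDS hinfo P V hV ?_ m m'
      (fun l hl => congrFun h1 ⟨l, hl⟩) h2)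
    · nlinarith
    · have := min_le_right kF rF
      omega

/-- The lower bound on the read bandwidth cost. -/
theorem splitBound_le_readBandwidthCost [Field F] [Fintype F] {lam rI rF : ℕ}
    (Z : SplitConvertibleCode F α (lam * kF + rI) (lam * kF) (kF + rF) kF)
    (hα : 1 ≤ α) (hlam : 2 ≤ lam) (hkF : 1 ≤ kF) (hrF : 1 ≤ rF) (hMDS : Z.IsMDS)
    (hsys : Z.IsSystematic) : splitBound lam kF rI rF α ≤ Z.readBandwidthCost := by
  classical
  obtain ⟨info, hinfo⟩ := hsys.1
  have hlog : 0 < Real.log (Fintype.card F) :=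
    Real.log_pos (by exact_mod_cast Fintype.one_lt_card)
  have hcost : Z.readBandwidthCost =
      (Z.readSystem hα hlam hkF hMDS info hinfo).cost / Real.log (Fintype.card F) := by
    unfold readBandwidthCost ReadSystem.cost
    rw [sum_eq_sum_embedding_add info, add_div, Finset.sum_div, Finset.sum_div]
    congr 1
    · exact Finset.sum_congr rfl fun i _ => entropy_map_uniform _ _
    · exact Finset.sum_congr rfl fun i _ => entropy_map_uniform _ _
  rw [hcost, le_div_iff₀ hlog]
  refine ReadSystem.splitBound_mul_le_cost hkF hrF (by omega) _ ?_ ?_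
  · have := (Z.readSystem hα hlam hkF hMDS info hinfo).card_index
    rw [Fintype.card_fin] at this
    exact (Nat.eq_of_mul_eq_mul_right (by omega) this).symm
  · rw [Fintype.card_subtype_compl, Fintype.card_fin]
    have : Fintype.card {i // i ∈ Set.range info} = lam * kF := by
      rw [← Fintype.card_congr (Equiv.ofInjective info info.injective), Fintype.card_fin]
    omega

end SplitConvertibleCode

/-! ### Superregular matrices over finite fields -/

/-- Every square submatrix of `a` is nonsingular.  This is stated in the form in which the MDS
property uses it: a vector with at most `n` nonzero entries that is orthogonal to `n` rows
vanishes. -/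
def Superregular {F ρ ι : Type*} [CommRing F] [Fintype ι] (a : ρ → ι → F) : Prop :=
  ∀ (R : Finset ρ) (J : Finset ι) (v : ι → F), J.card ≤ R.card → (∀ i, i ∉ J → v i = 0) →
    (∀ l ∈ R, ∑ i, a l i * v i = 0) → v = 0

/-- A nonzero polynomial with `n` terms has at most `n - 1` sign changes. -/
theorem signVariations_lt_card_support (p : Polynomial ℝ) (hp : p ≠ 0) :
    p.signVariations < p.support.card := by
  induction hn : p.support.card generalizing p with
  | zero => simp_all
  | succ n ih =>
    have hc := Polynomial.card_support_eraseLead' hn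
    by_cases h0 : p.eraseLead = 0
    · have : p.signVariations ≤ p.eraseLead.signVariations + 1 :=
        p.signVariations_le_eraseLead_succ
      have hmon : p = Polynomial.monomial p.natDegree p.leadingCoeff := by
        conv_lhs => rw [← p.eraseLead_add_monomial_natDegree_leadingCoeff, h0, zero_add]
      rw [hmon, Polynomial.signVariations_monomial]
      omega
    · have := ih p.eraseLead h0 hc
      have h2 := p.signVariations_le_eraseLead_succ
      omega

/-- Generalized Vandermonde matrices with positive nodes are nonsingular, by Descartes' rule of
signs. -/
theorem det_generalized_vandermonde_ne_zero {n : ℕ} (x : Fin n → ℝ) (hx : ∀ i, 0 < x i)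
    (hinj : Function.Injective x) (e : Fin n → ℕ) (he : Function.Injective e) :
    (Matrix.of fun i j => x i ^ e j).det ≠ 0 := by
  classical
  intro hdet
  obtain ⟨v, hv, hv0⟩ := Matrix.exists_mulVec_eq_zero_iff.2 hdet
  -- a vector in the kernel gives a polynomial with `n` positive roots and at most `n` terms
  set p : Polynomial ℝ := ∑ j, Polynomial.monomial (e j) (v j) with hp
  have hcoeff : ∀ j, p.coeff (e j) = v j := by
    intro j
    rw [hp, Polynomial.finsetSum_coeff, Finset.sum_eq_single j]
    · simp
    · intro j' _ hj'
      rw [Polynomial.coeff_monomial, if_neg fun h => hj' (he h)]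
    · simp
  have hp0 : p ≠ 0 := by
    intro h
    apply hv
    funext j
    rw [← hcoeff j, h]
    simp
  have hroot : ∀ i, p.IsRoot (x i) := by
    intro i
    have := congrFun hv0 i
    simp only [Matrix.mulVec, dotProduct, Matrix.of_apply, Pi.zero_apply] at this
    rw [Polynomial.IsRoot, hp, Polynomial.eval_finsetSum, ← this]
    refine Finset.sum_congr rfl fun j _ => ?_
    rw [Polynomial.eval_monomial, mul_comm]
  have hsupp : p.support.card ≤ n := by
    have : p.support ⊆ Finset.univ.image e := by
      intro d hd
      rw [Polynomial.mem_support_iff, hp, Polynomial.finsetSum_coeff] at hd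
      obtain ⟨j, -, hj⟩ := Finset.exists_ne_zero_of_sum_ne_zero hd
      rw [Polynomial.coeff_monomial] at hj
      exact Finset.mem_image.2 ⟨j, Finset.mem_univ _, by by_contra h; simp [h] at hj⟩
    refine (Finset.card_le_card this).trans (Finset.card_image_le.trans ?_)
    simp
  have hcount : n ≤ p.roots.countP (0 < ·) := by
    rw [Multiset.countP_eq_card_filter]
    have hle : (Finset.univ.map ⟨x, hinj⟩).val ≤ p.roots.filter (0 < ·) := by
      rw [Multiset.le_iff_subset (Finset.nodup _)]
      intro y hy
      obtain ⟨i, -, rfl⟩ := Finset.mem_map.1 (Finset.mem_def.2 hy)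
      exact Multiset.mem_filter.2 ⟨(Polynomial.mem_roots hp0).2 (hroot i), hx i⟩
    have := Multiset.card_le_card hle
    simpa using this
  have h1 := p.roots_countP_pos_le_signVariations
  have h2 := signVariations_lt_card_support p hp0
  omega

/-- For a suitable prime `p`, the matrix of powers `(l + 1) ^ i` is superregular modulo `p`: its
minors are nonzero integers, and `p` is chosen not to divide any of them. -/
theorem exists_prime_superregular (N K : ℕ) :
    ∃ p : ℕ, p.Prime ∧ N < p ∧
      Superregular fun (l : Fin N) (i : Fin K) => (((l : ℕ) + 1 : ℕ) : ZMod p) ^ (i : ℕ) := by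
  classical
  set minor : (Σ n : Fin (K + 1), (Fin n ↪ Fin N) × (Fin n ↪ Fin K)) → ℤ := fun x =>
    (Matrix.of fun i j => (((x.2.1 i : ℕ) + 1 : ℕ) : ℤ) ^ (x.2.2 j : ℕ)).det with hminor
  have hne : ∀ x, minor x ≠ 0 := by
    intro x hx
    refine det_generalized_vandermonde_ne_zero (fun i => (((x.2.1 i : ℕ) + 1 : ℕ) : ℝ))
      (fun i => by positivity) (fun i j h => ?_) (fun j => (x.2.2 j : ℕ))
      (fun i j h => x.2.2.injective (Fin.ext h)) ?_
    · have : (x.2.1 i : ℕ) + 1 = (x.2.1 j : ℕ) + 1 := Nat.cast_injective (R := ℝ) h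
      exact x.2.1.injective (Fin.ext (by omega))
    · have := congrArg (Int.castRingHom ℝ) hx
      rw [hminor, RingHom.map_det, map_zero] at this
      rw [← this]
      congr 1
      ext i j
      simp
  obtain ⟨p, hpge, hp⟩ := Nat.exists_infinite_primes (N + (∏ x, minor x).natAbs + 1)
  have : Fact p.Prime := ⟨hp⟩
  have hmod : ∀ x, ((minor x : ℤ) : ZMod p) ≠ 0 := by
    intro x hx
    rw [ZMod.intCast_zmod_eq_zero_iff_dvd] at hx
    have h1 : (p : ℤ) ∣ ∏ x, minor x := hx.trans (Finset.dvd_prod_of_mem _ (Finset.mem_univ x))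
    have h2 : (∏ x, minor x) ≠ 0 := Finset.prod_ne_zero_iff.2 fun x _ => hne x
    have h3 := Nat.le_of_dvd (Int.natAbs_pos.2 h2) (Int.natCast_dvd.1 h1)
    omega
  refine ⟨p, hp, by omega, fun R J v hJR hvJ hR => ?_⟩
  obtain ⟨R', hR', hR'c⟩ := Finset.exists_subset_card_eq hJR
  have hJK : J.card < K + 1 := by
    have := Finset.card_le_univ J
    rw [Fintype.card_fin] at this
    omega
  have hdet := hmod ⟨⟨J.card, hJK⟩, (R'.orderEmbOfFin hR'c).toEmbedding,
    (J.orderEmbOfFin rfl).toEmbedding⟩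
  rw [hminor] at hdet
  have hcast := RingHom.map_det (Int.castRingHom (ZMod p))
    (Matrix.of fun (i j : Fin J.card) =>
      ((((R'.orderEmbOfFin hR'c) i : ℕ) + 1 : ℕ) : ℤ) ^ ((J.orderEmbOfFin rfl) j : ℕ))
  have hsum : ∀ g : Fin K → ZMod p, ∑ x ∈ J, g x = ∑ j, g (J.orderEmbOfFin rfl j) := by
    intro g
    have h := Finset.sum_map Finset.univ (J.orderEmbOfFin rfl).toEmbedding g
    rw [Finset.map_orderEmbOfFin_univ] at h
    exact h
  have hz : (fun j => v (J.orderEmbOfFin rfl j)) = 0 := by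
    by_contra hv0
    refine hdet (hcast.trans (Matrix.exists_mulVec_eq_zero_iff.1 ⟨_, hv0, funext fun i => ?_⟩))
    have h1 := hR _ (hR' (Finset.orderEmbOfFin_mem R' hR'c i))
    rw [← Finset.sum_subset (Finset.subset_univ J)
      fun i _ hi => by rw [hvJ i hi, mul_zero]] at h1
    rw [hsum] at h1
    simp only [Matrix.mulVec, dotProduct, Pi.zero_apply]
    rw [← h1]
    refine Finset.sum_congr rfl fun j _ => ?_
    simp
  funext i
  by_cases hi : i ∈ J
  · have : i ∈ Set.range (J.orderEmbOfFin rfl) := by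
      rw [Finset.range_orderEmbOfFin]
      exact hi
    obtain ⟨j, rfl⟩ := this
    exact congrFun hz j
  · exact hvJ i hi

/-- There are superregular matrices over finite fields whose column blocks are equal up to a
scaling of the rows. -/
theorem exists_superregular_blocks (N lam k : ℕ) :
    ∃ (F : Type) (_ : Field F) (_ : Fintype F) (c : Fin N → Fin lam → F) (b : Fin N → Fin k → F),
      (∀ l j, c l j ≠ 0) ∧ Superregular fun l (x : Fin lam × Fin k) => c l x.1 * b l x.2 := by
  obtain ⟨p, hp, hNp, hs⟩ := exists_prime_superregular N (lam * k)
  have : Fact p.Prime := ⟨hp⟩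
  refine ⟨ZMod p, inferInstance, inferInstance, fun l j => ((l + 1 : ℕ) : ZMod p) ^ (k * j : ℕ),
    fun l i => ((l + 1 : ℕ) : ZMod p) ^ (i : ℕ), fun l j => pow_ne_zero _ ?_, ?_⟩
  · rw [Ne, ZMod.natCast_eq_zero_iff]
    exact fun h => absurd (Nat.le_of_dvd (by omega) h) (by omega)
  · intro R J v hJR hvJ hR
    have h := hs R (J.map finProdFinEquiv.toEmbedding) (fun i => v (finProdFinEquiv.symm i))
      (by simpa using hJR) (fun i hi => hvJ _ fun h => hi (by simpa using h)) ?_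
    · funext x
      simpa using congrFun h (finProdFinEquiv x)
    · intro l hl
      rw [← hR l hl, ← Equiv.sum_comp finProdFinEquiv]
      refine Finset.sum_congr rfl fun x _ => ?_
      dsimp only
      rw [Equiv.symm_apply_apply, ← pow_add]
      congr 2
      simp [finProdFinEquiv, add_comm]

/-! ### Convertible codes from linear parity functions -/

/-- The MDS property of the systematic code with the additive parity function `par`, for blocks
indexed by `ι` with subsymbols indexed by `τ`: a message with at most `n` nonzero blocks is zero
if `n` of its parity blocks are zero. -/
def ParityMDS {F ρ ι τ : Type*} [Zero F] (par : (ι → τ → F) → ρ → τ → F) : Prop :=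
  ∀ (R : Finset ρ) (J : Finset ι) (m : ι → τ → F), J.card ≤ R.card → (∀ i, i ∉ J → m i = 0) →
    (∀ l ∈ R, par m l = 0) → m = 0

section

variable {F ι τ : Type*} {α K s : ℕ}

/-- The systematic vector code with parity function `par`; `e` and `a` number the blocks and the
subsymbols. -/
def systematicCode (e : Fin K ≃ ι) (a : τ ≃ Fin α) (par : (ι → τ → F) → Fin s → τ → F) :
    VectorCode F α (K + s) K where
  enc m := Fin.append m fun l x => par (fun i t => m (e.symm i) (a t)) l (a.symm x)
  injective m m' h := by
    funext i
    simpa using congrFun h (Fin.castAdd s i)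

theorem systematicCode_enc_castAdd (e : Fin K ≃ ι) (a : τ ≃ Fin α)
    (par : (ι → τ → F) → Fin s → τ → F) (m : Fin K → Block F α) (i : Fin K) :
    (systematicCode e a par).enc m (Fin.castAdd s i) = m i := by
  simp [systematicCode]

theorem systematicCode_enc_natAdd (e : Fin K ≃ ι) (a : τ ≃ Fin α)
    (par : (ι → τ → F) → Fin s → τ → F) (m : Fin K → Block F α) (l : Fin s) :
    (systematicCode e a par).enc m (Fin.natAdd K l) =
      fun x => par (fun i t => m (e.symm i) (a t)) l (a.symm x) := by
  simp [systematicCode]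

theorem systematicCode_isSystematicAt (e : Fin K ≃ ι) (a : τ ≃ Fin α)
    (par : (ι → τ → F) → Fin s → τ → F) :
    (systematicCode e a par).IsSystematicAt (Fin.castAddEmb s) :=
  fun m i => systematicCode_enc_castAdd e a par m i

theorem systematicCode_isMDS [Ring F] (e : Fin K ≃ ι) (a : τ ≃ Fin α)
    (par : (ι → τ → F) → Fin s → τ → F) (hsub : ∀ x y, par (x - y) = par x - par y)
    (hpar : ParityMDS par) : (systematicCode e a par).IsMDS := by
  classical
  intro S hS m m' h
  set A : Finset (Fin K) := Finset.univ.filter fun i => Fin.castAdd s i ∈ S with hA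
  set R : Finset (Fin s) := Finset.univ.filter fun l => Fin.natAdd K l ∈ S with hR
  have hcard : A.card + R.card = K := by
    rw [hA, hR, Finset.card_filter, Finset.card_filter,
      ← Fin.sum_univ_add (fun i : Fin (K + s) => if i ∈ S then 1 else 0), ← Finset.card_filter,
      Finset.filter_mem_eq_inter, Finset.univ_inter, hS]
  have hc := Finset.card_add_card_compl A
  rw [Fintype.card_fin] at hc
  have key := hpar R (Aᶜ.map e.toEmbedding)
    ((fun i t => m (e.symm i) (a t)) - fun i t => m' (e.symm i) (a t))
    (by rw [Finset.card_map]; omega) ?_ ?_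
  · funext i x
    have := congrFun (congrFun key (e i)) (a.symm x)
    simpa [sub_eq_zero] using this
  · intro i hi
    have hi' : e.symm i ∈ A := by simpa using hi
    have := h _ (Finset.mem_filter.1 hi').2
    rw [systematicCode_enc_castAdd, systematicCode_enc_castAdd] at this
    funext t
    simp [this]
  · intro l hl
    have := h _ (Finset.mem_filter.1 hl).2
    rw [systematicCode_enc_natAdd, systematicCode_enc_natAdd] at this
    rw [hsub]
    funext t
    have ht := congrFun this (a t)
    simp only [Equiv.symm_apply_apply] at ht
    simp [ht]

end

/-- The message indices of the `j`-th stripe. -/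
def consecutiveStripe (lam k : ℕ) (j : Fin lam) : Finset (Fin (lam * k)) :=
  Finset.univ.filter fun x => (finProdFinEquiv.symm x).1 = j

theorem mem_consecutiveStripe {lam k : ℕ} {j : Fin lam} {x : Fin (lam * k)} :
    x ∈ consecutiveStripe lam k j ↔ (finProdFinEquiv.symm x).1 = j := by
  simp [consecutiveStripe]

/-- The partition of the message indices into stripes of `k` consecutive indices. -/
def consecutivePartition (lam k : ℕ) (hk : 0 < k) :
    Finpartition (Finset.univ : Finset (Fin (lam * k))) :=
  Finpartition.ofExistsUnique (Finset.univ.image (consecutiveStripe lam k))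
    (fun _ _ => Finset.subset_univ _)
    (fun x _ => by
      refine ⟨consecutiveStripe lam k (finProdFinEquiv.symm x).1,
        ⟨Finset.mem_image_of_mem _ (Finset.mem_univ _), mem_consecutiveStripe.2 rfl⟩, ?_⟩
      rintro P ⟨hP, hx⟩
      obtain ⟨j, -, rfl⟩ := Finset.mem_image.1 hP
      rw [mem_consecutiveStripe.1 hx])
    (by
      intro h
      obtain ⟨j, -, hj⟩ := Finset.mem_image.1 h
      have : finProdFinEquiv (j, (⟨0, hk⟩ : Fin k)) ∈ consecutiveStripe lam k j :=
        mem_consecutiveStripe.2 (by rw [Equiv.symm_apply_apply])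
      rw [hj] at this
      exact Finset.notMem_empty _ this)

theorem card_consecutiveStripe (lam k : ℕ) (j : Fin lam) :
    (consecutiveStripe lam k j).card = k := by
  have : consecutiveStripe lam k j =
      Finset.univ.map ⟨fun i : Fin k => finProdFinEquiv (j, i),
        fun i i' h => by simpa using h⟩ := by
    ext x
    rw [mem_consecutiveStripe]
    constructor
    · rintro rfl
      exact Finset.mem_map.2 ⟨(finProdFinEquiv.symm x).2, Finset.mem_univ _,
        finProdFinEquiv.apply_symm_apply x⟩
    · intro hx
      obtain ⟨i, -, rfl⟩ := Finset.mem_map.1 hx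
      exact congrArg Prod.fst (finProdFinEquiv.symm_apply_apply (j, i))
  rw [this, Finset.card_map, Finset.card_univ, Fintype.card_fin]

theorem exists_stripe_of_mem_parts {lam k : ℕ} {hk : 0 < k}
    (P : (consecutivePartition lam k hk).parts) : ∃ j, consecutiveStripe lam k j = P := by
  obtain ⟨j, -, hj⟩ := Finset.mem_image.1 P.2
  exact ⟨j, hj⟩

/-- The number of a part of the partition into consecutive stripes. -/
noncomputable def stripeIndex {lam k : ℕ} {hk : 0 < k}
    (P : (consecutivePartition lam k hk).parts) : Fin lam :=
  (exists_stripe_of_mem_parts P).choose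

theorem consecutiveStripe_stripeIndex {lam k : ℕ} {hk : 0 < k}
    (P : (consecutivePartition lam k hk).parts) : consecutiveStripe lam k (stripeIndex P) = P :=
  (exists_stripe_of_mem_parts P).choose_spec

theorem orderEmbOfFin_part {lam k : ℕ} {hk : 0 < k} (P : (consecutivePartition lam k hk).parts)
    (h : (P : Finset (Fin (lam * k))).card = k) (i : Fin k) :
    (P : Finset (Fin (lam * k))).orderEmbOfFin h i = finProdFinEquiv (stripeIndex P, i) := by
  have := Finset.orderEmbOfFin_unique h (f := fun i => finProdFinEquiv (stripeIndex P, i)) ?_ ?_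
  · exact (congrFun this i).symm
  · intro i
    rw [← consecutiveStripe_stripeIndex P]
    exact mem_consecutiveStripe.2 (by rw [Equiv.symm_apply_apply])
  · intro i i' hi
    rw [Fin.lt_def] at hi ⊢
    simpa [finProdFinEquiv] using hi

/-- Parity functions for the initial and the final code together with sets of subsymbols to read
yield a convertible code, if the subsymbols read determine the final parities.  Its cost is at
most the number of subsymbols read. -/
theorem exists_convertibleCode {F τ : Type} [Field F] [Fintype F] [Fintype τ]
    {lam k s r : ℕ} (hk : 0 < k)
    (parI : (Fin lam × Fin k → τ → F) → Fin s → τ → F) (parF : (Fin k → τ → F) → Fin r → τ → F)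
    (hsubI : ∀ x y, parI (x - y) = parI x - parI y)
    (hsubF : ∀ x y, parF (x - y) = parF x - parF y)
    (hI : ParityMDS parI) (hF : ParityMDS parF)
    (readI : Fin lam × Fin k → Finset τ) (readP : Fin s → Finset τ)
    (hdet : ∀ m : Fin lam × Fin k → τ → F, (∀ x, ∀ t ∈ readI x, m x t = 0) →
      (∀ l, ∀ t ∈ readP l, parI m l t = 0) → ∀ j, parF (fun i => m (j, i)) = 0) :
    ∃ Z : SplitConvertibleCode F (Fintype.card τ) (lam * k + s) (lam * k) (k + r) k,
      Z.IsMDS ∧ Z.IsSystematic ∧ Z.KeepsInformationNodes ∧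
        Z.readBandwidthCost ≤ ∑ x, ((readI x).card : ℝ) + ∑ l, ((readP l).card : ℝ) := by
  classical
  set a : τ ≃ Fin (Fintype.card τ) := Fintype.equivFin τ
  set CI := systematicCode finProdFinEquiv.symm a parI with hCI
  set CF := systematicCode (Equiv.refl (Fin k)) a parF with hCF
  set readSet : Fin (lam * k + s) → Finset τ :=
    Fin.append (fun x => readI (finProdFinEquiv.symm x)) readP with hreadSet
  set rd : (i : Fin (lam * k + s)) → Block F (Fintype.card τ) → ({t // t ∈ readSet i} → F) :=
    fun i c t => c (a t.1) with hrd
  set ψ : (Fin (lam * k) → Block F (Fintype.card τ)) →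
    ((i : Fin (lam * k + s)) → ({t // t ∈ readSet i} → F)) := fun m i => rd i (CI.enc m i) with hψ
  set φ : (Fin (lam * k) → Block F (Fintype.card τ)) →
    Fin lam → Fin r → Block F (Fintype.card τ) :=
    fun m j l => CF.enc (fun i => m (finProdFinEquiv (j, i))) (Fin.natAdd k l) with hφ
  -- the data read determine the new nodes, so that `write` can be an extension of this dependence
  have hfac : φ.FactorsThrough ψ := by
    intro m m' h
    have key := hdet ((fun x t => m (finProdFinEquiv x) (a t)) -
      fun x t => m' (finProdFinEquiv x) (a t)) ?_ ?_
    · funext j l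
      simp only [hφ, hCF, systematicCode_enc_natAdd]
      funext x
      have h1 := congrFun (congrFun (key j) l) (a.symm x)
      have h2 := congrFun (congrFun (hsubF (fun i t => m (finProdFinEquiv (j, i)) (a t))
        (fun i t => m' (finProdFinEquiv (j, i)) (a t))) l) (a.symm x)
      exact sub_eq_zero.1 (h2.symm.trans h1)
    · intro x t ht
      have hmem : t ∈ readSet (Fin.castAdd s (finProdFinEquiv x)) := by
        simp only [hreadSet, Fin.append_left, Equiv.symm_apply_apply]
        exact ht
      have := congrFun (congrFun h (Fin.castAdd s (finProdFinEquiv x))) ⟨t, hmem⟩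
      simp only [hψ, hrd, hCI, systematicCode_enc_castAdd] at this
      exact sub_eq_zero.2 this
    · intro l t ht
      have hmem : t ∈ readSet (Fin.natAdd (lam * k) l) := by
        simpa [hreadSet] using ht
      have := congrFun (congrFun h (Fin.natAdd (lam * k) l)) ⟨t, hmem⟩
      simp only [hψ, hrd, hCI, systematicCode_enc_natAdd, Equiv.symm_apply_apply,
        Equiv.symm_symm] at this
      rw [hsubI]
      exact sub_eq_zero.2 this
  let Z : SplitConvertibleCode F (Fintype.card τ) (lam * k + s) (lam * k) (k + r) k :=
    { initial := CI
      final := CF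
      partition := consecutivePartition lam k hk
      card_part := fun P hP => by
        have h := card_consecutiveStripe lam k (stripeIndex ⟨P, hP⟩)
        rw [consecutiveStripe_stripeIndex ⟨P, hP⟩] at h
        exact h
      source := fun P => Fin.append
        (fun i => some (Fin.castAdd s (finProdFinEquiv (stripeIndex P, i)))) fun _ => none
      source_inj := by
        intro P P' l l' i h h'
        induction l using Fin.addCases with
        | right l => simp at h
        | left l =>
          induction l' using Fin.addCases with
          | right l' => simp at h'
          | left l' =>
            rw [Fin.append_left, Option.some.injEq] at h h'
            have e := finProdFinEquiv.injective (Fin.castAdd_injective _ _ (h.trans h'.symm))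
            rw [Prod.mk.injEq] at e
            refine ⟨Subtype.ext ?_, by rw [e.2]⟩
            rw [← consecutiveStripe_stripeIndex P, e.1, consecutiveStripe_stripeIndex P']
      Download := fun i => {t // t ∈ readSet i} → F
      read := rd
      write := fun D P => Fin.append (fun _ => 0)
        (Function.extend ψ φ (fun _ _ _ => 0) D (stripeIndex P))
      unchanged_correct := by
        intro m P l i h
        induction l using Fin.addCases with
        | right l => simp at h
        | left l =>
          rw [Fin.append_left, Option.some.injEq] at h
          rw [← h, hCI, hCF, systematicCode_enc_castAdd, systematicCode_enc_castAdd,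
            orderEmbOfFin_part]
      new_correct := by
        intro m P l h
        induction l using Fin.addCases with
        | left l => simp at h
        | right l =>
          rw [Fin.append_right]
          change _ = Function.extend ψ φ (fun _ _ _ => 0) (ψ m) (stripeIndex P) l
          rw [hfac.extend_apply]
          simp only [hφ, orderEmbOfFin_part] }
  have hsysI : Z.initial.IsSystematicAt (Fin.castAddEmb s) := systematicCode_isSystematicAt _ _ _
  have hsysF : Z.final.IsSystematicAt (Fin.castAddEmb r) := systematicCode_isSystematicAt _ _ _
  refine ⟨Z, ⟨systematicCode_isMDS _ _ _ hsubI hI, systematicCode_isMDS _ _ _ hsubF hF⟩,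
    ⟨⟨_, hsysI⟩, ⟨_, hsysF⟩⟩, ⟨_, _, hsysI, hsysF, ?_⟩, ?_⟩
  · intro P j
    refine (Fin.append_left (fun i => some (Fin.castAdd s (finProdFinEquiv (stripeIndex P, i))))
      (fun _ => none) j).trans ?_
    congr 2
    exact (orderEmbOfFin_part P _ j).symm
  · have hlog : 0 < Real.log (Fintype.card F) :=
      Real.log_pos (by exact_mod_cast Fintype.one_lt_card)
    have hle : Z.readBandwidthCost ≤ ∑ i, ((readSet i).card : ℝ) := by
      refine Finset.sum_le_sum fun i _ => ?_
      rw [entropy_map_uniform, div_le_iff₀ hlog]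
      refine (partitionEntropy_ker_le_log_card _).trans (le_of_eq ?_)
      change Real.log (Fintype.card ({t // t ∈ readSet i} → F)) = _
      rw [Fintype.card_fun, Fintype.card_coe, Nat.cast_pow, Real.log_pow]
    refine hle.trans (le_of_eq ?_)
    rw [Fin.sum_univ_add, ← Equiv.sum_comp finProdFinEquiv]
    simp only [hreadSet, Fin.append_left, Fin.append_right, Equiv.symm_apply_apply]

/-! ### Codes attaining the bound -/

section Constructions

variable {F : Type} [Field F] {N lam k : ℕ}

theorem Superregular.parityMDS {ρ ι τ : Type*} [Fintype ι] {a : ρ → ι → F} (ha : Superregular a) :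
    ParityMDS fun (m : ι → τ → F) l t => a l ⬝ᵥ fun i => m i t := by
  intro R J m hJR hm hR
  funext i t
  exact congrFun (ha R J (fun i => m i t) hJR (fun i hi => congrFun (hm i hi) t)
    fun l hl => congrFun (hR l hl) t) i

theorem Superregular.comp_injective {ρ ρ' ι : Type*} [Fintype ι] {a : ρ → ι → F}
    (ha : Superregular a) {e : ρ' → ρ} (he : Function.Injective e) :
    Superregular fun l => a (e l) := by
  intro R J v hJR hv hR
  refine ha (R.map ⟨e, he⟩) J v (by rwa [Finset.card_map]) hv fun l hl => ?_
  obtain ⟨l', hl', rfl⟩ := Finset.mem_map.1 hl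
  exact hR l' hl'

/-- The matrix consisting of one block for each stripe; the blocks are equal up to a scaling of
the rows by `c`. -/
def blockMatrix (c : Fin N → Fin lam → F) (b : Fin N → Fin k → F) :
    Fin N → Fin lam × Fin k → F :=
  fun l x => c l x.1 * b l x.2

theorem blockMatrix_dotProduct (c : Fin N → Fin lam → F) (b : Fin N → Fin k → F) (l : Fin N)
    (w : Fin lam × Fin k → F) (j : Fin lam) (hw : ∀ x, x.1 ≠ j → w x = 0) :
    blockMatrix c b l ⬝ᵥ w = c l j * (b l ⬝ᵥ fun i => w (j, i)) := by
  simp only [dotProduct, blockMatrix, Fintype.sum_prod_type]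
  rw [Finset.sum_eq_single j, Finset.mul_sum]
  · exact Finset.sum_congr rfl fun i _ => mul_assoc _ _ _
  · intro j' _ hj'
    exact Finset.sum_eq_zero fun i _ => by rw [hw (j', i) hj', mul_zero]
  · simp

theorem Superregular.of_blockMatrix {c : Fin N → Fin lam → F} {b : Fin N → Fin k → F}
    (h : Superregular (blockMatrix c b)) (hlam : 0 < lam) : Superregular b := by
  classical
  intro R J v hJR hv hR
  set w : Fin lam × Fin k → F := fun x => if x.1 = ⟨0, hlam⟩ then v x.2 else 0 with hw
  have := h R (J.map ⟨fun i => ((⟨0, hlam⟩ : Fin lam), i), Prod.mk_right_injective _⟩) w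
    (by rwa [Finset.card_map]) ?_ ?_
  · funext i
    simpa [hw] using congrFun this (⟨0, hlam⟩, i)
  · rintro ⟨j, i⟩ hx
    by_cases hj : j = ⟨0, hlam⟩
    · subst hj
      simpa [hw] using hv i (by simpa using hx)
    · simp [hw, hj]
  · intro l hl
    have e := blockMatrix_dotProduct c b l w ⟨0, hlam⟩ fun x hx => by simp [hw, hx]
    refine e.trans ?_
    have e2 : (b l ⬝ᵥ fun i => w (⟨0, hlam⟩, i)) = 0 := by
      simp only [hw, if_true]
      exact hR l hl
    rw [e2, mul_zero]

/-- For `k ≤ r` all information nodes are read. -/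
theorem exists_convertibleCode_of_le [Fintype F] {s r : ℕ} (hk : 0 < k) (hlam : 0 < lam)
    (hs : s ≤ N) (hr : r ≤ N) {c : Fin N → Fin lam → F} {b : Fin N → Fin k → F}
    (h : Superregular (blockMatrix c b)) :
    ∃ Z : SplitConvertibleCode F 1 (lam * k + s) (lam * k) (k + r) k,
      Z.IsMDS ∧ Z.IsSystematic ∧ Z.KeepsInformationNodes ∧ Z.readBandwidthCost ≤ lam * k := by
  refine (exists_convertibleCode (F := F) (τ := Unit) (s := s) (r := r) hk
    (fun m l t => blockMatrix c b (Fin.castLE hs l) ⬝ᵥ fun x => m x t)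
    (fun m l t => b (Fin.castLE hr l) ⬝ᵥ fun x => m x t)
    (fun x y => by funext l t; exact dotProduct_sub _ _ _)
    (fun x y => by funext l t; exact dotProduct_sub _ _ _)
    (h.comp_injective (Fin.castLE_injective hs)).parityMDS
    ((h.of_blockMatrix hlam).comp_injective (Fin.castLE_injective hr)).parityMDS
    (fun _ => Finset.univ) (fun _ => ∅) ?_).imp
    fun Z h => ⟨h.1, h.2.1, h.2.2.1, h.2.2.2.trans (by simp)⟩
  · intro m hm _ j
    funext l t
    have : (fun i => m (j, i) t) = 0 := funext fun i => hm (j, i) t (Finset.mem_univ t)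
    change _ ⬝ᵥ (fun i => m (j, i) t) = 0
    rw [this, dotProduct_zero]

/-- The parity function of the initial code for `s ≤ r`.  The last `r - s` subsymbols of the
parity node `l` carry as piggybacks the final parities `s`, …, `r - 1` of the subsymbol `l` of the
stripe `0`. -/
def fewParitiesInitial {s r : ℕ} (hsr : s ≤ r) (hlam : 0 < lam) (c : Fin r → Fin lam → F)
    (b : Fin r → Fin k → F) (m : Fin lam × Fin k → Fin s ⊕ Fin (r - s) → F) (l : Fin s)
    (t : Fin s ⊕ Fin (r - s)) : F :=
  (blockMatrix c b (Fin.castLE hsr l) ⬝ᵥ fun x => m x t) +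
    Sum.elim (fun _ => 0)
      (fun v : Fin (r - s) => b ⟨s + v, by omega⟩ ⬝ᵥ fun i => m (⟨0, hlam⟩, i) (Sum.inl l)) t

/-- The subsymbols without piggybacks are decoded first; they determine the piggybacks. -/
theorem fewParitiesInitial_parityMDS {s r : ℕ} (hsr : s ≤ r) (hlam : 0 < lam)
    {c : Fin r → Fin lam → F} {b : Fin r → Fin k → F} (h : Superregular (blockMatrix c b)) :
    ParityMDS (fewParitiesInitial hsr hlam c b) := by
  intro R J m hJR hm hR
  have h' := h.comp_injective (Fin.castLE_injective hsr)
  have hl : ∀ u x, m x (Sum.inl u) = 0 := by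
    intro u x
    refine congrFun (h' R J (fun x => m x (Sum.inl u)) hJR
      (fun i hi => congrFun (hm i hi) _) fun l hl => ?_) x
    have := congrFun (hR l hl) (Sum.inl u)
    simp only [fewParitiesInitial, Sum.elim_inl, add_zero] at this
    exact this
  have hr : ∀ v x, m x (Sum.inr v) = 0 := by
    intro v x
    refine congrFun (h' R J (fun x => m x (Sum.inr v)) hJR
      (fun i hi => congrFun (hm i hi) _) fun l hlR => ?_) x
    have := congrFun (hR l hlR) (Sum.inr v)
    have hz : (fun i => m (⟨0, hlam⟩, i) (Sum.inl l)) = 0 := funext fun i => hl l _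
    simp only [fewParitiesInitial, Sum.elim_inr, hz, dotProduct_zero, add_zero] at this
    exact this
  funext x t
  rcases t with u | v
  · exact hl u x
  · exact hr v x

/-- For `s ≤ r` all nodes are read completely, except that the first `s` of the `r` subsymbols
are not read from the information nodes of the stripe `0`. -/
theorem exists_convertibleCode_of_few_parities [Fintype F] {s r : ℕ} (hk : 0 < k) (hlam : 0 < lam)
    (hsr : s ≤ r) {c : Fin r → Fin lam → F} {b : Fin r → Fin k → F} (hc : ∀ l j, c l j ≠ 0)
    (h : Superregular (blockMatrix c b)) :
    ∃ Z : SplitConvertibleCode F r (lam * k + s) (lam * k) (k + r) k,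
      Z.IsMDS ∧ Z.IsSystematic ∧ Z.KeepsInformationNodes ∧
        Z.readBandwidthCost ≤ lam * k * r - s * (k - r) := by
  classical
  have hcard : Fintype.card (Fin s ⊕ Fin (r - s)) = r := by simp; omega
  have key : ∃ Z : SplitConvertibleCode F (Fintype.card (Fin s ⊕ Fin (r - s))) (lam * k + s)
      (lam * k) (k + r) k, Z.IsMDS ∧ Z.IsSystematic ∧ Z.KeepsInformationNodes ∧
      Z.readBandwidthCost ≤ lam * k * r - s * (k - r) := by
    refine (exists_convertibleCode (F := F) (τ := Fin s ⊕ Fin (r - s))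
      (s := s) (r := r) hk (fewParitiesInitial hsr hlam c b) (fun m l t => b l ⬝ᵥ fun i => m i t)
      (fun x y => by
        funext l t
        rcases t with u | v
        · simp only [fewParitiesInitial, Sum.elim_inl, add_zero, Pi.sub_apply]
          exact dotProduct_sub _ _ _
        · simp only [fewParitiesInitial, Sum.elim_inr, Pi.sub_apply]
          rw [add_sub_add_comm, ← dotProduct_sub, ← dotProduct_sub]
          rfl)
      (fun x y => by funext l t; exact dotProduct_sub _ _ _)
      (fewParitiesInitial_parityMDS hsr hlam h) (h.of_blockMatrix hlam).parityMDS
      (fun x => if x.1 = ⟨0, hlam⟩ then Finset.univ.map ⟨Sum.inr, Sum.inr_injective⟩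
        else Finset.univ) (fun _ => Finset.univ) ?_).imp
      fun Z h => ⟨h.1, h.2.1, h.2.2.1, h.2.2.2.trans (le_of_eq ?_)⟩
    · intro m hm hp j
      have hread : ∀ x, x.1 ≠ ⟨0, hlam⟩ → ∀ t, m x t = 0 := by
        intro x hx t
        exact hm x t (by simp [hx])
      have hread' : ∀ x v, m x (Sum.inr v) = 0 := by
        intro x v
        refine hm x _ ?_
        split_ifs <;> simp
      funext l t
      change b l ⬝ᵥ (fun i => m (j, i) t) = 0
      by_cases hj : j = ⟨0, hlam⟩
      · subst hj
        rcases t with u | v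
        · by_cases hls : (l : ℕ) < s
          · have := hp ⟨l, hls⟩ (Sum.inl u) (Finset.mem_univ _)
            simp only [fewParitiesInitial, Sum.elim_inl, add_zero] at this
            rw [blockMatrix_dotProduct c b _ _ ⟨0, hlam⟩ fun x hx => hread x hx _] at this
            exact (mul_eq_zero.1 this).resolve_left (hc _ _)
          · have := hp u (Sum.inr ⟨l - s, by omega⟩) (Finset.mem_univ _)
            have hz : (fun x => m x (Sum.inr ⟨l - s, by omega⟩)) = 0 := funext fun x => hread' x _
            simp only [fewParitiesInitial, Sum.elim_inr, hz, dotProduct_zero, zero_add] at this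
            have hl : (⟨s + (l - s), by omega⟩ : Fin r) = l := Fin.ext (by simp; omega)
            rwa [hl] at this
        · rw [show (fun i => m (⟨0, hlam⟩, i) (Sum.inr v)) = 0 from funext fun i => hread' _ v,
            dotProduct_zero]
      · rw [show (fun i => m (j, i) t) = 0 from funext fun i => hread (j, i) hj t, dotProduct_zero]
    · have hx : ∀ x : Fin lam × Fin k, (((if x.1 = ⟨0, hlam⟩ then
          Finset.univ.map ⟨Sum.inr, Sum.inr_injective⟩
          else Finset.univ : Finset (Fin s ⊕ Fin (r - s))).card : ℕ) : ℝ) =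
          r - if x.1 = ⟨0, hlam⟩ then (s : ℝ) else 0 := by
        intro x
        split_ifs
        · simp [Nat.cast_sub hsr]
        · rw [Finset.card_univ, hcard, sub_zero]
      have hs0 : ∑ x : Fin lam, ∑ _y : Fin k, (if x = ⟨0, hlam⟩ then (s : ℝ) else 0) = k * s := by
        rw [Finset.sum_comm]
        simp
      simp only [hx, Finset.sum_sub_distrib, Finset.card_univ, hcard, Fintype.sum_prod_type, hs0]
      simp
      ring
  rwa [hcard] at key

/-- The subsymbols of the code for `r < s`: `r` exclusive subsymbols for each stripe and `s - r`
common ones. -/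
abbrev PiggybackIndex (lam r s : ℕ) : Type := (Fin lam × Fin r) ⊕ Fin (s - r)

/-- The alignment of the subsymbols of the stripe `j` with those of the parity nodes: within its
final codeword every stripe has its exclusive subsymbols at the position `0`. -/
def alignment {r s : ℕ} (hlam : 0 < lam) (j : Fin lam) :
    PiggybackIndex lam r s → PiggybackIndex lam r s :=
  Sum.map (Prod.map (Equiv.swap ⟨0, hlam⟩ j) id) id

/-- The parity function of the final code for `r < s`.  The parity `r + v` of the `l`-th
exclusive subsymbol is a piggyback on the common subsymbol `v` of the parity node `l`. -/
def piggybackFinal {r s : ℕ} (hrs : r ≤ s) (hlam : 0 < lam) (b : Fin s → Fin k → F)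
    (m : Fin k → PiggybackIndex lam r s → F) (l : Fin r) (t : PiggybackIndex lam r s) : F :=
  (b (Fin.castLE hrs l) ⬝ᵥ fun i => m i t) +
    Sum.elim (fun _ => 0)
      (fun v : Fin (s - r) => b ⟨r + v, by omega⟩ ⬝ᵥ fun i => m i (Sum.inl (⟨0, hlam⟩, l))) t

/-- The parity function of the initial code for `r < s`.  The parity nodes `r + v` carry on the
exclusive subsymbols of the stripe `j` as piggybacks the parities of the common subsymbol `v` of
this stripe. -/
def piggybackInitial {r s : ℕ} (hrs : r ≤ s) (hlam : 0 < lam) (c : Fin s → Fin lam → F)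
    (b : Fin s → Fin k → F) (m : Fin lam × Fin k → PiggybackIndex lam r s → F) (l : Fin s)
    (t : PiggybackIndex lam r s) : F :=
  (blockMatrix c b l ⬝ᵥ fun x => m x (alignment hlam x.1 t)) +
    Sum.elim (fun u => if h : r ≤ l then
      c l u.1 * (b (Fin.castLE hrs u.2) ⬝ᵥ fun i => m (u.1, i) (Sum.inr ⟨l - r, by omega⟩))
      else 0) (fun _ => 0) t

/-- The exclusive subsymbols carry no piggybacks and are decoded first. -/
theorem piggybackFinal_parityMDS {r s : ℕ} (hrs : r ≤ s) (hlam : 0 < lam) {b : Fin s → Fin k → F}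
    (h : Superregular b) : ParityMDS (piggybackFinal hrs hlam b) := by
  intro R J m hJR hm hR
  have h' := h.comp_injective (Fin.castLE_injective hrs)
  have hl : ∀ u i, m i (Sum.inl u) = 0 := by
    intro u i
    refine congrFun (h' R J (fun i => m i (Sum.inl u)) hJR
      (fun i hi => congrFun (hm i hi) _) fun l hl => ?_) i
    have := congrFun (hR l hl) (Sum.inl u)
    simp only [piggybackFinal, Sum.elim_inl, add_zero] at this
    exact this
  have hr : ∀ v i, m i (Sum.inr v) = 0 := by
    intro v i
    refine congrFun (h' R J (fun i => m i (Sum.inr v)) hJR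
      (fun i hi => congrFun (hm i hi) _) fun l hlR => ?_) i
    have := congrFun (hR l hlR) (Sum.inr v)
    have hz : (fun i => m i (Sum.inl (⟨0, hlam⟩, l))) = 0 := funext fun i => hl _ i
    simp only [piggybackFinal, Sum.elim_inr, hz, dotProduct_zero, add_zero] at this
    exact this
  funext i t
  rcases t with u | v
  · exact hl u i
  · exact hr v i

/-- The common subsymbols carry no piggybacks and are decoded first. -/
theorem piggybackInitial_parityMDS {r s : ℕ} (hrs : r ≤ s) (hlam : 0 < lam)
    {c : Fin s → Fin lam → F} {b : Fin s → Fin k → F} (h : Superregular (blockMatrix c b)) :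
    ParityMDS (piggybackInitial hrs hlam c b) := by
  intro R J m hJR hm hR
  have hr : ∀ v x, m x (Sum.inr v) = 0 := by
    intro v x
    refine congrFun (h R J (fun x => m x (Sum.inr v)) hJR
      (fun i hi => congrFun (hm i hi) _) fun l hlR => ?_) x
    have := congrFun (hR l hlR) (Sum.inr v)
    simp only [piggybackInitial, Sum.elim_inr, add_zero] at this
    exact this
  have hl : ∀ u x, m x (alignment hlam x.1 (Sum.inl u)) = 0 := by
    intro u x
    refine congrFun (h R J (fun x => m x (alignment hlam x.1 (Sum.inl u))) hJR
      (fun i hi => congrFun (hm i hi) _) fun l hlR => ?_) x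
    have := congrFun (hR l hlR) (Sum.inl u)
    have hz : ∀ v, (fun i => m (u.1, i) (Sum.inr v)) = 0 := fun v => funext fun i => hr v _
    simp only [piggybackInitial, Sum.elim_inl, hz, dotProduct_zero, mul_zero, dite_eq_ite,
      ite_self, add_zero] at this
    exact this
  funext x t
  rcases t with u | v
  · have := hl (Equiv.swap ⟨0, hlam⟩ x.1 u.1, u.2) x
    simpa [alignment] using this
  · exact hr v x

/-- For `r < s` the exclusive subsymbols of the other stripes are read from the information nodes
of each stripe, and all exclusive subsymbols are read from the parity nodes. -/
theorem exists_convertibleCode_of_many_parities [Fintype F] {s r : ℕ} (hk : 0 < k) (hlam : 0 < lam)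
    (hrs : r ≤ s) {c : Fin s → Fin lam → F} {b : Fin s → Fin k → F} (hc : ∀ l j, c l j ≠ 0)
    (h : Superregular (blockMatrix c b)) :
    ∃ Z : SplitConvertibleCode F (lam * r + (s - r)) (lam * k + s) (lam * k) (k + r) k,
      Z.IsMDS ∧ Z.IsSystematic ∧ Z.KeepsInformationNodes ∧
        Z.readBandwidthCost ≤ lam * r * ((lam - 1) * k + s) := by
  classical
  have hcard : Fintype.card (PiggybackIndex lam r s) = lam * r + (s - r) := by simp
  have key : ∃ Z : SplitConvertibleCode F (Fintype.card (PiggybackIndex lam r s)) (lam * k + s)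
      (lam * k) (k + r) k, Z.IsMDS ∧ Z.IsSystematic ∧ Z.KeepsInformationNodes ∧
      Z.readBandwidthCost ≤ lam * r * ((lam - 1) * k + s) := by
    refine (exists_convertibleCode (F := F) (τ := PiggybackIndex lam r s)
      (s := s) (r := r) hk (piggybackInitial hrs hlam c b) (piggybackFinal hrs hlam b)
      (fun x y => by
        funext l t
        rcases t with u | v
        · simp only [piggybackInitial, Sum.elim_inl, Pi.sub_apply]
          rw [add_sub_add_comm, ← dotProduct_sub]
          split_ifs
          · rw [← mul_sub, ← dotProduct_sub]
            rfl
          · rw [sub_zero]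
            rfl
        · simp only [piggybackInitial, Sum.elim_inr, add_zero, Pi.sub_apply]
          exact dotProduct_sub _ _ _)
      (fun x y => by
        funext l t
        rcases t with u | v
        · simp only [piggybackFinal, Sum.elim_inl, add_zero, Pi.sub_apply]
          exact dotProduct_sub _ _ _
        · simp only [piggybackFinal, Sum.elim_inr, Pi.sub_apply]
          rw [add_sub_add_comm, ← dotProduct_sub, ← dotProduct_sub]
          rfl)
      (piggybackInitial_parityMDS hrs hlam h)
      (piggybackFinal_parityMDS hrs hlam (h.of_blockMatrix hlam))
      (fun _ => ((Finset.univ.erase (⟨0, hlam⟩ : Fin lam)) ×ˢ Finset.univ).map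
        ⟨Sum.inl, Sum.inl_injective⟩)
      (fun _ => Finset.univ.map ⟨Sum.inl, Sum.inl_injective⟩) ?_).imp
      fun Z h => ⟨h.1, h.2.1, h.2.2.1, h.2.2.2.trans (le_of_eq ?_)⟩
    · intro m hm hp j
      have hread : ∀ x j' e, j' ≠ ⟨0, hlam⟩ → m x (Sum.inl (j', e)) = 0 := by
        intro x j' e hj'
        exact hm x _ (by simp [hj'])
      -- on the exclusive subsymbols of the stripe `j`, the other stripes do not contribute
      have hpar : ∀ l e, (c l j * (b l ⬝ᵥ fun i => m (j, i) (Sum.inl (⟨0, hlam⟩, e)))) +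
          (if h : r ≤ l then
            c l j * (b (Fin.castLE hrs e) ⬝ᵥ fun i => m (j, i) (Sum.inr ⟨l - r, by omega⟩))
            else 0) = 0 := by
        intro l e
        have := hp l (Sum.inl (j, e)) (by simp)
        simp only [piggybackInitial, Sum.elim_inl] at this
        rw [blockMatrix_dotProduct c b l _ j ?_] at this
        · simpa [alignment] using this
        · intro x hx
          refine hread x _ _ fun h0 => hx ?_
          have h0' := congrArg (Equiv.swap (⟨0, hlam⟩ : Fin lam) x.1) h0
          simpa using h0'.symm
      funext l t
      rcases t with ⟨j', e⟩ | v
      · simp only [piggybackFinal, Sum.elim_inl, add_zero, Pi.zero_apply]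
        by_cases hj' : j' = ⟨0, hlam⟩
        · subst hj'
          have := hpar (Fin.castLE hrs l) e
          rw [dif_neg (by simp), add_zero] at this
          exact (mul_eq_zero.1 this).resolve_left (hc _ _)
        · rw [show (fun i => m (j, i) (Sum.inl (j', e))) = 0 from funext fun i => hread _ _ _ hj',
            dotProduct_zero]
      · simp only [piggybackFinal, Sum.elim_inr, Pi.zero_apply]
        have := hpar ⟨r + v, by omega⟩ l
        rw [dif_pos (by simp), ← mul_add] at this
        have h0 := (mul_eq_zero.1 this).resolve_left (hc _ _)
        have hv : (⟨r + v - r, by omega⟩ : Fin (s - r)) = v := Fin.ext (by simp)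
        rw [add_comm]
        simpa only [hv] using h0
    · simp [Nat.cast_sub (Nat.succ_le_of_lt hlam)]
      ring
  rwa [hcard] at key

end Constructions

theorem splitBound_of_le {lam kF rI rF α : ℕ} (h : kF ≤ rF) :
    splitBound lam kF rI rF α = lam * kF * α := by
  unfold splitBound
  rw [if_neg (by omega), if_neg (by omega), if_neg (by omega), min_eq_left h]

theorem splitBound_of_few_parities {lam kF rI rF : ℕ} (hrF : 1 ≤ rF) (h : rI ≤ rF)
    (hr : rF < kF) :
    splitBound lam kF rI rF rF = lam * kF * rF - rI * (kF - rF) := by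
  have hr' : (rF : ℝ) ≠ 0 := by exact_mod_cast (by omega : rF ≠ 0)
  unfold splitBound
  rw [if_neg (by omega), if_neg (by omega), if_pos ⟨h, hr⟩]
  field_simp

theorem splitBound_of_many_parities {lam kF rI rF : ℕ} (hlam : 2 ≤ lam) (hrF : 1 ≤ rF)
    (h : rF < rI) (hI : rI ≤ kF) (hr : rF < kF) :
    splitBound lam kF rI rF (lam * rF + (rI - rF)) = lam * rF * ((lam - 1) * kF + rI) := by
  have hIlam : rI ≤ lam * kF := hI.trans (Nat.le_mul_of_pos_left kF (by omega))
  have hk' : (0 : ℝ) < kF := by exact_mod_cast (by omega : 0 < kF)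
  have hlam' : (1 : ℝ) ≤ lam := by exact_mod_cast (by omega : 1 ≤ lam)
  have hI' : (0 : ℝ) < rI := by exact_mod_cast (by omega : 0 < rI)
  have hpos : (0 : ℝ) < (lam - 1) * rF + rI := by
    have : (0 : ℝ) ≤ (lam - 1) * rF := mul_nonneg (by linarith) (Nat.cast_nonneg _)
    linarith
  have hα : ((lam * rF + (rI - rF) : ℕ) : ℝ) = (lam - 1) * rF + rI := by
    rw [Nat.cast_add, Nat.cast_sub h.le, Nat.cast_mul]
    ring
  unfold splitBound
  rw [hα]
  rcases hI.lt_or_eq with hlt | heq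
  · have hmod : rI % kF = rI := Nat.mod_eq_of_lt hlt
    have hceil : ⌈(rI : ℝ) / kF⌉ = 1 := by
      rw [Int.ceil_eq_iff]
      have h1 : (0 : ℝ) < rI / kF := div_pos hI' hk'
      have h2 : (rI : ℝ) / kF ≤ 1 := by
        rw [div_le_one hk']
        exact_mod_cast hI
      push_cast
      constructor <;> linarith
    rw [if_pos ⟨h, hIlam, hr, by omega⟩, hceil]
    push_cast
    rw [mul_assoc _ _ (_ / _), mul_div_cancel₀ _ hpos.ne']
  · -- for `rI = kF` the second case of the bound agrees with the formula of the first
    subst heq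
    have hfloor : ⌊(rI : ℝ) / rI⌋ = 1 := by
      rw [div_self hI'.ne']
      simp
    rw [if_neg (by rw [Nat.mod_self]; omega),
      if_pos ⟨h, hIlam, hr, by rw [Nat.mod_self]; omega⟩, hfloor]
    push_cast
    have hpos' := hpos.ne'
    rw [one_mul]
    field_simp
    ring

end MDSConversion

theorem mainTheorem1 (lam kF rI rF : ℕ) (hlam : 2 ≤ lam) (hkF : 1 ≤ kF) (hrF : 1 ≤ rF) :
    (∀ (F : Type*) [Field F] [Fintype F] (α : ℕ), 1 ≤ α →
      ∀ Z : MDSConversion.SplitConvertibleCode F α (lam * kF + rI) (lam * kF) (kF + rF) kF,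
        Z.IsMDS → Z.IsSystematic →
          MDSConversion.splitBound lam kF rI rF α ≤ Z.readBandwidthCost) ∧
    (kF ≤ rF ∨ rI ≤ kF →
      ∃ (F : Type) (_ : Field F) (_ : Fintype F) (α : ℕ)
        (Z : MDSConversion.SplitConvertibleCode F α (lam * kF + rI) (lam * kF) (kF + rF) kF),
        1 ≤ α ∧ Z.IsMDS ∧ Z.IsSystematic ∧ Z.KeepsInformationNodes ∧
          Z.readBandwidthCost = MDSConversion.splitBound lam kF rI rF α) := by
  refine ⟨fun F _ _ α hα Z hMDS hsys =>
    Z.splitBound_le_readBandwidthCost hα hlam hkF hrF hMDS hsys, fun hpar => ?_⟩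
  -- by the lower bound it suffices to find a code whose cost does not exceed the bound
  suffices h : ∃ (F : Type) (_ : Field F) (_ : Fintype F) (α : ℕ)
      (Z : MDSConversion.SplitConvertibleCode F α (lam * kF + rI) (lam * kF) (kF + rF) kF),
      1 ≤ α ∧ Z.IsMDS ∧ Z.IsSystematic ∧ Z.KeepsInformationNodes ∧
        Z.readBandwidthCost ≤ MDSConversion.splitBound lam kF rI rF α by
    obtain ⟨F, hF, hF', α, Z, hα, hMDS, hsys, hkeep, hle⟩ := h
    exact ⟨F, hF, hF', α, Z, hα, hMDS, hsys, hkeep,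
      le_antisymm hle (Z.splitBound_le_readBandwidthCost hα hlam hkF hrF hMDS hsys)⟩
  rcases le_or_gt kF rF with hkr | hkr
  · obtain ⟨F, hF, hF', c, b, -, hs⟩ :=
      MDSConversion.exists_superregular_blocks (max rI rF) lam kF
    obtain ⟨Z, h1, h2, h3, h4⟩ := MDSConversion.exists_convertibleCode_of_le (s := rI) (r := rF)
      hkF (by omega) (le_max_left _ _) (le_max_right _ _) hs
    refine ⟨F, hF, hF', 1, Z, le_rfl, h1, h2, h3, ?_⟩
    rw [MDSConversion.splitBound_of_le hkr]
    simpa using h4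
  · have hI : rI ≤ kF := hpar.resolve_left (by omega)
    rcases le_or_gt rI rF with hsr | hsr
    · obtain ⟨F, hF, hF', c, b, hc, hs⟩ := MDSConversion.exists_superregular_blocks rF lam kF
      obtain ⟨Z, h1, h2, h3, h4⟩ := MDSConversion.exists_convertibleCode_of_few_parities
        hkF (by omega) hsr hc hs
      refine ⟨F, hF, hF', rF, Z, hrF, h1, h2, h3, ?_⟩
      rwa [MDSConversion.splitBound_of_few_parities hrF hsr hkr]
    · obtain ⟨F, hF, hF', c, b, hc, hs⟩ := MDSConversion.exists_superregular_blocks rI lam kF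
      obtain ⟨Z, h1, h2, h3, h4⟩ := MDSConversion.exists_convertibleCode_of_many_parities
        hkF (by omega) hsr.le hc hs
      refine ⟨F, hF, hF', _, Z, by omega, h1, h2, h3, ?_⟩
      rwa [MDSConversion.splitBound_of_many_parities hlam hrF hsr hI hkr]
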